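/- Consider turnstile streams over $[n]$: an update is a pair $(a,\Delta)\in X=[n]\times\{\pm1\}$, a stream $\vec u$ has the frequency vector $f_a(\vec u)=\sum_{(a,\Delta)\in \vec u}\Delta$, and $F_2(\vec u)=\sum_{a\in[n]} f_a(\vec u)^2$. In the ASA game (adversarial streaming with advice) with query/advice rate $\eta\ge 1$, stream length $m$ and at most $T$ queries, a randomized streaming algorithm plays against an adaptive, possibly randomized and computationally unbounded adversary. In each round $i=1,\dots,m$: (1) the adversary, who knows all previous updates and responses, chooses an update $x_i\in X$ and a query demand $q_i\in\{0,1\}$, subject to $\sum_{j\le i}q_j\le T$; (2) the algorithm processes $x_i$; (3) if $q_i=1$, the algorithm outputs a response $z_i\in\mathbb R$, which is given to the adversary, and if moreover $\sum_{j\le i}q_j\equiv 0 \pmod \eta$, the algorithm specifies a predicate $p_i:X^*\to\{0,1\}$ and obtains the bit $p_i(x_1,\dots,x_i)$. The algorithm uses space $S$ if everything it carries from one step to the next, stored random strings included, is kept in $S$ bits of memory; it may toss fresh coins in each step. Theorem ($F_2$ estimation in the ASA model). There are universal constants $C>0$ and $c\in\mathbb N$ such that for all integers $\eta\ge1$ and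 $n,m\ge 0$ and all real $\alpha,\beta>0$ there is a streaming algorithm for the ASA game with query/advice rate $\eta$ and stream length $m$ that uses space $$S\;\le\; C\cdot\frac{\eta}{\alpha^4}\cdot\log^{c}\Bigl(2+\frac{nm}{\alpha\beta}\Bigr)\;=\;\tilde O\Bigl(\frac{\eta}{\alpha^4}\Bigr)$$ and such that, for every $T$ and every adversary making at most $T$ queries, with probability at least $1-\beta$ every response satisfies $|z_i-F_2(x_1,\dots,x_i)|\le\alpha\,F_2(x_1,\dots,x_i)$. -/

import Mathlib

noncomputable section

namespace ASA

/-- A randomized streaming algorithm over the update domain `X`, with `S` bits of memory, for the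
adversarial streaming game with advice. Everything that is carried from one step to the next,
random strings included, has to be kept in the `S` bits; each step may toss fresh coins. -/
structure Algorithm (X : Type) (S : ℕ) where
  /-- the distribution of the initial memory content -/
  init : PMF (Fin S → Bool)
  /-- processing of an update -/
  update : (Fin S → Bool) → X → PMF (Fin S → Bool)
  /-- answering a query: the new memory content and the response -/
  respond : (Fin S → Bool) → PMF ((Fin S → Bool) × ℝ)
  /-- the predicate specified when a bit of advice is granted -/
  predicate : (Fin S → Bool) → List X → Bool
  /-- processing of the bit of advice -/
  receive : (Fin S → Bool) → Bool → PMF (Fin S → Bool)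

/-- What the adversary has seen so far, oldest round first: for every round the update, together
with the response if there was a query in that round (`none` if there was no query). -/
abbrev History (X : Type) : Type := List (X × Option ℝ)

/-- The stream of the updates so far. -/
def History.stream {X : Type} (h : History X) : List X := h.map Prod.fst

/-- The number of queries made so far. -/
def History.queries {X : Type} (h : History X) : ℕ := h.countP fun r => r.2.isSome

/-- A randomized, adaptive, computationally unbounded adversary: given the history it chooses the
next update and the next query demand. -/
abbrev Adversary (X : Type) : Type := History X → PMF (X × Bool)

/-- The adversary makes at most `T` queries: after `T` queries it never demands another one. -/
def Adversary.WithinBudget {X : Type} (adv : Adversary X) (T : ℕ) : Prop :=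
  ∀ h : History X, T ≤ h.queries → ∀ move ∈ (adv h).support, move.2 = false

/-- One round of the game with query/advice rate `η`, from a memory content and a history to the
next memory content and the next history. -/
def playRound {X : Type} {S : ℕ} (η : ℕ) (alg : Algorithm X S) (adv : Adversary X)
    (c : (Fin S → Bool) × History X) : PMF ((Fin S → Bool) × History X) :=
  (adv c.2).bind fun move =>
  (alg.update c.1 move.1).bind fun s₁ =>
  if move.2 = true then
    (alg.respond s₁).bind fun answer =>
    let h : History X := c.2 ++ [(move.1, some answer.2)]
    if h.queries % η = 0 then
      (alg.receive answer.1 (alg.predicate answer.1 h.stream)).bind fun s₂ => PMF.pure (s₂, h)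
    else PMF.pure (answer.1, h)
  else PMF.pure (s₁, c.2 ++ [(move.1, none)])

/-- The joint distribution of the memory content and the history after `m` rounds. -/
def play {X : Type} {S : ℕ} (η : ℕ) (alg : Algorithm X S) (adv : Adversary X) :
    ℕ → PMF ((Fin S → Bool) × History X)
  | 0 => alg.init.bind fun s => PMF.pure (s, [])
  | m + 1 => (play η alg adv m).bind (playRound η alg adv)

/-- Every response is in `(1 ± α) · g` of the stream up to and including its round. -/
def History.Accurate {X : Type} (g : List X → ℝ) (α : ℝ) (h : History X) : Prop :=
  ∀ (i : ℕ) (x : X) (z : ℝ), h[i]? = some (x, some z) →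
    |z - g (History.stream (h.take (i + 1)))| ≤ α * |g (History.stream (h.take (i + 1)))|

/-- In the game with query/advice rate `η`, stream length `m` and at most `T` queries, against
every adversary, all responses are `α`-accurate for `g` except with probability at most `β`. -/
def Algorithm.IsRobust {X : Type} {S : ℕ} (alg : Algorithm X S) (g : List X → ℝ)
    (η m T : ℕ) (α β : ℝ) : Prop :=
  ∀ adv : Adversary X, adv.WithinBudget T →
    ENNReal.ofReal (1 - β) ≤
      (play η alg adv m).toOuterMeasure {c | History.Accurate g α c.2}

/-- An update `(a, Δ)` of a turnstile stream over `n` elements, `Δ = ± 1`. -/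
abbrev Update (n : ℕ) : Type := Fin n × ℤˣ

/-- The frequency of `a`: the sum of the increments `Δ` of the updates to `a`. -/
def freq {n : ℕ} (u : List (Update n)) (a : Fin n) : ℤ :=
  (u.map fun p => if p.1 = a then (p.2 : ℤ) else 0).sum

/-- The second frequency moment. -/
def F₂ {n : ℕ} (u : List (Update n)) : ℝ := ∑ a : Fin n, (freq u a : ℝ) ^ 2

end ASA

end

open scoped ENNReal

noncomputable section

namespace ASA

/-! ### Expectations of nonnegative functions under discrete distributions -/

/-- The expectation of a nonnegative function under a discrete distribution. -/
def expect {α : Type*} (p : PMF α) (f : α → ℝ≥0∞) : ℝ≥0∞ := ∑' a, p a * f a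

section expect

variable {α β γ : Type*}

lemma expect_pure (a : α) (f : α → ℝ≥0∞) : expect (PMF.pure a) f = f a := by
  rw [expect, tsum_eq_single a]
  · simp
  · intro b hb
    simp [PMF.pure_apply, hb]

lemma expect_bind (p : PMF α) (k : α → PMF β) (f : β → ℝ≥0∞) :
    expect (p.bind k) f = expect p fun a => expect (k a) f := by
  simp only [expect, PMF.bind_apply, ← ENNReal.tsum_mul_right, ← ENNReal.tsum_mul_left]
  rw [ENNReal.tsum_comm]
  simp only [mul_assoc]

lemma expect_map (p : PMF α) (g : α → β) (f : β → ℝ≥0∞) :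
    expect (p.map g) f = expect p fun a => f (g a) := by
  rw [← PMF.bind_pure_comp, expect_bind]
  simp [expect_pure]

lemma expect_congr {p : PMF α} {f g : α → ℝ≥0∞} (h : ∀ a ∈ p.support, f a = g a) :
    expect p f = expect p g := by
  refine tsum_congr fun a => ?_
  by_cases ha : p a = 0
  · simp [ha]
  · rw [h a ((p.mem_support_iff a).2 ha)]

lemma expect_mono_support {p : PMF α} {f g : α → ℝ≥0∞} (h : ∀ a ∈ p.support, f a ≤ g a) :
    expect p f ≤ expect p g := by
  refine ENNReal.tsum_le_tsum fun a => ?_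
  by_cases ha : p a = 0
  · simp [ha]
  · exact mul_le_mul_right (h a ((p.mem_support_iff a).2 ha)) _

lemma expect_mono {p : PMF α} {f g : α → ℝ≥0∞} (h : ∀ a, f a ≤ g a) :
    expect p f ≤ expect p g :=
  expect_mono_support fun a _ => h a

lemma expect_const (p : PMF α) (c : ℝ≥0∞) : expect p (fun _ => c) = c := by
  rw [expect, ENNReal.tsum_mul_right, p.tsum_coe, one_mul]

lemma expect_add (p : PMF α) (f g : α → ℝ≥0∞) :
    expect p (fun a => f a + g a) = expect p f + expect p g := by
  simp only [expect, mul_add, ENNReal.tsum_add]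

lemma expect_sum {ι : Type*} (p : PMF α) (s : Finset ι) (f : ι → α → ℝ≥0∞) :
    expect p (fun a => ∑ i ∈ s, f i a) = ∑ i ∈ s, expect p (f i) := by
  simp only [expect, Finset.mul_sum]
  exact Summable.tsum_finsetSum fun _ _ => ENNReal.summable

lemma expect_const_mul (p : PMF α) (c : ℝ≥0∞) (f : α → ℝ≥0∞) :
    expect p (fun a => c * f a) = c * expect p f := by
  simp only [expect, ← ENNReal.tsum_mul_left]
  exact tsum_congr fun a => by ring

lemma expect_comm (p : PMF α) (q : PMF β) (f : α → β → ℝ≥0∞) :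
    expect p (fun a => expect q (f a)) = expect q fun b => expect p fun a => f a b := by
  simp only [expect, ← ENNReal.tsum_mul_left]
  rw [ENNReal.tsum_comm]
  exact tsum_congr fun b => tsum_congr fun a => by ring

lemma expect_indicator (p : PMF α) (s : Set α) :
    expect p (s.indicator 1) = p.toOuterMeasure s := by
  rw [PMF.toOuterMeasure_apply]
  refine tsum_congr fun a => ?_
  by_cases h : a ∈ s <;> simp [h]

lemma ENNReal_two_mul_le_add_sq (a b : ℝ≥0∞) : 2 * (a * b) ≤ a ^ 2 + b ^ 2 := by
  rcases eq_or_ne a ⊤ with rfl | ha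
  · simp
  rcases eq_or_ne b ⊤ with rfl | hb
  · simp
  lift a to NNReal using ha
  lift b to NNReal using hb
  norm_cast
  rw [← NNReal.coe_le_coe]
  push_cast
  nlinarith [sq_nonneg ((a : ℝ) - b)]

/-- The Cauchy-Schwarz inequality for weighted sums of extended nonnegative reals. -/
lemma sq_tsum_mul_mul_le (w f g : α → ℝ≥0∞) :
    (∑' a, w a * (f a * g a)) ^ 2 ≤ (∑' a, w a * f a ^ 2) * ∑' a, w a * g a ^ 2 := by
  have h2 : (2 : ℝ≥0∞) * (∑' a, w a * (f a * g a)) ^ 2 ≤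
      2 * ((∑' a, w a * f a ^ 2) * ∑' a, w a * g a ^ 2) := by
    calc (2 : ℝ≥0∞) * (∑' a, w a * (f a * g a)) ^ 2
        = ∑' a, ∑' b, w a * w b * (2 * ((f a * g b) * (f b * g a))) := by
          rw [sq]
          simp only [← ENNReal.tsum_mul_left, ← ENNReal.tsum_mul_right]
          exact tsum_congr fun a => tsum_congr fun b => by ring
      _ ≤ ∑' a, ∑' b, w a * w b * ((f a * g b) ^ 2 + (f b * g a) ^ 2) :=
          ENNReal.tsum_le_tsum fun a => ENNReal.tsum_le_tsum fun b =>
            mul_le_mul_right (ENNReal_two_mul_le_add_sq _ _) _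
      _ = (∑' a, ∑' b, w a * f a ^ 2 * (w b * g b ^ 2)) +
            ∑' a, ∑' b, w a * g a ^ 2 * (w b * f b ^ 2) := by
          rw [← ENNReal.tsum_add]
          refine tsum_congr fun a => ?_
          rw [← ENNReal.tsum_add]
          exact tsum_congr fun b => by ring
      _ = 2 * ((∑' a, w a * f a ^ 2) * ∑' a, w a * g a ^ 2) := by
          simp only [ENNReal.tsum_mul_left, ENNReal.tsum_mul_right]
          ring
  exact (ENNReal.mul_le_mul_iff_right (by simp) (by simp)).1 h2

lemma sq_expect_le (p : PMF α) (f : α → ℝ≥0∞) :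
    expect p f ^ 2 ≤ expect p fun a => f a ^ 2 := by
  simpa [expect, p.tsum_coe] using sq_tsum_mul_mul_le p f 1

lemma expect_uniform [Fintype α] [Nonempty α] (f : α → ℝ≥0∞) :
    expect (PMF.uniformOfFintype α) f = (Fintype.card α : ℝ≥0∞)⁻¹ * ∑ a, f a := by
  rw [expect, tsum_fintype, Finset.mul_sum]
  simp

/-- Summing over all values of one coordinate of a tuple, and then over all tuples. -/
lemma sum_sum_update {ι K M : Type*} [Fintype ι] [DecidableEq ι] [Fintype K] [AddCommMonoid M]
    (j : ι) (f : (ι → K) → M) :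
    ∑ A : ι → K, ∑ a : K, f (Function.update A j a) = Fintype.card K • ∑ A : ι → K, f A := by
  calc ∑ A : ι → K, ∑ a : K, f (Function.update A j a)
      = ∑ p : (ι → K) × K, f (Function.update p.1 j p.2) := by
        rw [Fintype.sum_prod_type]
    _ = ∑ p : (ι → K) × K, f p.1 := by
        refine Fintype.sum_equiv
          (Function.Involutive.toPerm
            (fun p : (ι → K) × K => (Function.update p.1 j p.2, p.1 j)) ?_) _ _ ?_
        · intro p
          simp
        · intro p
          rfl
    _ = Fintype.card K • ∑ A : ι → K, f A := by
        rw [Fintype.sum_prod_type]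
        simp [Finset.smul_sum]

/-- In a tuple of independent uniform entries, any entry may be drawn anew. -/
lemma expect_uniform_update {ι K : Type*} [Fintype ι] [DecidableEq ι] [Fintype K] [Nonempty K]
    (j : ι) (f : (ι → K) → ℝ≥0∞) :
    expect (PMF.uniformOfFintype (ι → K))
        (fun A => expect (PMF.uniformOfFintype K) fun a => f (Function.update A j a)) =
      expect (PMF.uniformOfFintype (ι → K)) f := by
  simp only [expect_uniform]
  rw [← Finset.mul_sum, sum_sum_update, nsmul_eq_mul, ← mul_assoc ((Fintype.card K : ℝ≥0∞)⁻¹),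
    ENNReal.inv_mul_cancel (by simp) (by simp), one_mul]

end expect

/-! ### Selection by exponential weights -/

section selection

variable {ι Z : Type*}

open Classical in
/-- The weight of a candidate: `b` to the power of the number of its votes. -/
def voteWeight (b : ℝ≥0∞) (J : Finset ι) (V : ι → Set Z) (z : Z) : ℝ≥0∞ :=
  b ^ (J.filter fun i => z ∈ V i).card

lemma one_le_voteWeight {b : ℝ≥0∞} (hb : 1 ≤ b) (J : Finset ι) (V : ι → Set Z) (z : Z) :
    1 ≤ voteWeight b J V z := one_le_pow₀ hb

variable [Fintype Z] [Nonempty Z]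

open Classical in
/-- Select a candidate with probability proportional to its weight (and candidates
uniformly if the base of the weights is degenerate). -/
def select (b : ℝ≥0∞) (J : Finset ι) (V : ι → Set Z) : PMF Z :=
  if h : 1 ≤ b ∧ b ≠ ⊤ then
    PMF.normalize (voteWeight b J V)
      (by
        obtain ⟨z⟩ := ‹Nonempty Z›
        intro h0
        have := ENNReal.tsum_eq_zero.1 h0 z
        exact absurd (this ▸ one_le_voteWeight h.1 J V z) (by simp))
      (by
        rw [tsum_fintype]
        exact ENNReal.sum_ne_top.2 fun z _ => ENNReal.pow_ne_top h.2)
  else PMF.uniformOfFintype Z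

lemma expect_select {b : ℝ≥0∞} (hb : 1 ≤ b) (hb' : b ≠ ⊤) (J : Finset ι) (V : ι → Set Z)
    (f : Z → ℝ≥0∞) :
    expect (select b J V) f =
      (∑ z, voteWeight b J V z * f z) * (∑ z, voteWeight b J V z)⁻¹ := by
  rw [expect, select, dif_pos ⟨hb, hb'⟩, tsum_fintype, Finset.sum_mul]
  refine Finset.sum_congr rfl fun z _ => ?_
  rw [PMF.normalize_apply, tsum_fintype]
  ring

lemma select_congr (b : ℝ≥0∞) (J : Finset ι) {V V' : ι → Set Z} (h : ∀ i ∈ J, V i = V' i) :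
    select b J V = select b J V' := by
  classical
  have : voteWeight b J V = voteWeight b J V' := by
    funext z
    unfold voteWeight
    congr 2
    exact Finset.filter_congr fun i hi => by rw [h i hi]
  unfold select
  simp only [this]

/-- If one candidate has all the votes, candidates without votes are rarely selected. -/
lemma expect_select_indicator_le {b : ℝ≥0∞} (hb : 1 ≤ b) (hb' : b ≠ ⊤) (J : Finset ι)
    (V : ι → Set Z) (z₀ : Z) (hz₀ : ∀ i ∈ J, z₀ ∈ V i) (B : Set Z)
    (hB : ∀ z ∈ B, ∀ i ∈ J, z ∉ V i) :
    expect (select b J V) (B.indicator 1) ≤ Fintype.card Z * (b ^ J.card)⁻¹ := by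
  classical
  rw [expect_select hb hb']
  refine mul_le_mul' ?_ (ENNReal.inv_le_inv.2 ?_)
  · calc ∑ z, voteWeight b J V z * B.indicator 1 z ≤ ∑ _z : Z, (1 : ℝ≥0∞) := by
          refine Finset.sum_le_sum fun z _ => ?_
          by_cases hz : z ∈ B
          · have : J.filter (fun i => z ∈ V i) = ∅ :=
              Finset.filter_eq_empty_iff.2 fun i hi => hB z hz i hi
            simp [voteWeight, this, hz]
          · simp [hz]
      _ = Fintype.card Z := by simp
  · have : voteWeight b J V z₀ = b ^ J.card := by
      rw [voteWeight, Finset.filter_true_of_mem hz₀]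
    rw [← this]
    exact Finset.single_le_sum (f := voteWeight b J V) (fun _ _ => zero_le) (Finset.mem_univ z₀)

/-- Removing one voter changes the selection only a little, in the sense of the chi-squared
divergence. -/
lemma sq_expect_select_le [DecidableEq ι] (θ : NNReal) (J : Finset ι) (V : ι → Set Z) (j : ι)
    (hj : j ∈ J) (f : Z → ℝ≥0∞) :
    expect (select (1 + θ : NNReal) J V) f ^ 2 ≤
      (1 + θ ^ 2 : NNReal) *
        expect (select (1 + θ : NNReal) (J.erase j) V) fun z => f z ^ 2 := by
  classical
  have hb : (1 : ℝ≥0∞) ≤ (1 + θ : NNReal) := by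
    exact_mod_cast le_self_add
  have hb' : ((1 + θ : NNReal) : ℝ≥0∞) ≠ ⊤ := ENNReal.coe_ne_top
  rw [expect_select hb hb', expect_select hb hb']
  set b : ℝ≥0∞ := ((1 + θ : NNReal) : ℝ≥0∞) with hbdef
  set w := voteWeight b (J.erase j) V with hw
  let g : Z → ℝ≥0∞ := fun z => if z ∈ V j then b else 1
  have hwg : ∀ z, voteWeight b J V z = w z * g z := by
    intro z
    simp only [hw, g, voteWeight]
    conv_lhs => rw [← Finset.insert_erase hj]
    rw [Finset.filter_insert]
    split_ifs with h
    · rw [Finset.card_insert_of_notMem (by simp), pow_succ]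
    · rw [mul_one]
  have hpos : ∀ z, 1 ≤ w z := one_le_voteWeight hb _ _
  have hfin : ∀ z, w z ≠ ⊤ := fun z => ENNReal.pow_ne_top hb'
  simp only [hwg]
  have hCS : (∑ z, w z * g z * f z) ^ 2 ≤ (∑ z, w z * g z ^ 2) * ∑ z, w z * f z ^ 2 := by
    simpa [tsum_fintype, mul_assoc] using sq_tsum_mul_mul_le w g f
  have hvar : (∑ z, w z * g z ^ 2) * (∑ z, w z) ≤ (1 + θ ^ 2 : NNReal) * (∑ z, w z * g z) ^ 2 := by
    have e1 : ∑ z, w z = ∑ z with z ∈ V j, w z + ∑ z with z ∉ V j, w z :=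
      (Finset.sum_filter_add_sum_filter_not _ _ _).symm
    have e2 : ∑ z, w z * g z = (∑ z with z ∈ V j, w z) * b + ∑ z with z ∉ V j, w z := by
      rw [← Finset.sum_filter_add_sum_filter_not Finset.univ (fun z => z ∈ V j), Finset.sum_mul]
      congr 1
      · exact Finset.sum_congr rfl fun z hz => by simp [g, (Finset.mem_filter.1 hz).2]
      · exact Finset.sum_congr rfl fun z hz => by simp [g, (Finset.mem_filter.1 hz).2]
    have e3 : ∑ z, w z * g z ^ 2 = (∑ z with z ∈ V j, w z) * b ^ 2 + ∑ z with z ∉ V j, w z := by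
      rw [← Finset.sum_filter_add_sum_filter_not Finset.univ (fun z => z ∈ V j), Finset.sum_mul]
      congr 1
      · exact Finset.sum_congr rfl fun z hz => by simp [g, (Finset.mem_filter.1 hz).2]
      · exact Finset.sum_congr rfl fun z hz => by simp [g, (Finset.mem_filter.1 hz).2]
    rw [e1, e2, e3]
    have f1 : ∑ z with z ∈ V j, w z ≠ ⊤ := ENNReal.sum_ne_top.2 fun z _ => hfin z
    have f2 : ∑ z with z ∉ V j, w z ≠ ⊤ := ENNReal.sum_ne_top.2 fun z _ => hfin z
    generalize ∑ z with z ∈ V j, w z = a at f1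
    generalize ∑ z with z ∉ V j, w z = c at f2
    lift a to NNReal using f1
    lift c to NNReal using f2
    rw [hbdef]
    norm_cast
    rw [← NNReal.coe_le_coe]
    push_cast
    have ha : (0 : ℝ) ≤ a := a.2
    have hc : (0 : ℝ) ≤ c := c.2
    have ht : (0 : ℝ) ≤ θ := θ.2
    have : 0 ≤ (θ : ℝ) ^ 2 * ((a * (1 + θ) + c) ^ 2 - a * c) := by
      refine mul_nonneg (sq_nonneg _) ?_
      have : 0 ≤ (a : ℝ) * c := mul_nonneg ha hc
      have : 0 ≤ (a : ℝ) * c * θ := by positivity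
      nlinarith [sq_nonneg ((a : ℝ) * (1 + θ)), sq_nonneg (c : ℝ)]
    nlinarith
  have hN : (∑ z, w z) ≠ 0 := by
    obtain ⟨z⟩ := ‹Nonempty Z›
    intro h0
    have := (Finset.sum_eq_zero_iff.1 h0) z (Finset.mem_univ z)
    exact absurd (this ▸ hpos z) (by simp)
  have hN' : (∑ z, w z) ≠ ⊤ := ENNReal.sum_ne_top.2 fun z _ => hfin z
  have hM : (∑ z, w z * g z) ≠ 0 := by
    obtain ⟨z⟩ := ‹Nonempty Z›
    intro h0
    have := (Finset.sum_eq_zero_iff.1 h0) z (Finset.mem_univ z)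
    rw [← hwg] at this
    exact absurd (this ▸ one_le_voteWeight hb J V z) (by simp)
  have hM' : (∑ z, w z * g z) ≠ ⊤ := by
    refine ENNReal.sum_ne_top.2 fun z _ => ?_
    rw [← hwg]
    exact ENNReal.pow_ne_top hb'
  have hMM : (∑ z, w z * g z) * (∑ z, w z * g z)⁻¹ = 1 := ENNReal.mul_inv_cancel hM hM'
  have hNN : (∑ z, w z) * (∑ z, w z)⁻¹ = 1 := ENNReal.mul_inv_cancel hN hN'
  generalize (∑ z, w z * g z)⁻¹ = Mi at hMM ⊢
  generalize (∑ z, w z)⁻¹ = Ni at hNN ⊢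
  generalize (∑ z, w z * g z) = M at *
  generalize (∑ z, w z) = N at *
  calc ((∑ z, w z * g z * f z) * Mi) ^ 2
      = (∑ z, w z * g z * f z) ^ 2 * Mi ^ 2 * (N * Ni) := by rw [hNN]; ring
    _ ≤ ((∑ z, w z * g z ^ 2) * ∑ z, w z * f z ^ 2) * Mi ^ 2 * (N * Ni) := by gcongr
    _ = ((∑ z, w z * g z ^ 2) * N) * ((∑ z, w z * f z ^ 2) * Mi ^ 2 * Ni) := by ring
    _ ≤ ((1 + θ ^ 2 : NNReal) * M ^ 2) * ((∑ z, w z * f z ^ 2) * Mi ^ 2 * Ni) := by gcongr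
    _ = (1 + θ ^ 2 : NNReal) * ((∑ z, w z * f z ^ 2) * Ni) * (M * Mi) ^ 2 := by ring
    _ = _ := by rw [hMM]; ring

end selection

end ASA

end

noncomputable section

namespace ASA

/-! ### Histories -/

section history

variable {X : Type}

lemma queries_append_none (h : History X) (x : X) :
    History.queries (h ++ [(x, none)]) = h.queries := by
  simp [History.queries]

lemma queries_append_some (h : History X) (x : X) (z : ℝ) :
    History.queries (h ++ [(x, some z)]) = h.queries + 1 := by
  simp [History.queries]

lemma stream_append (h : History X) (r : X × Option ℝ) :
    History.stream (h ++ [r]) = h.stream ++ [r.1] := by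
  simp [History.stream]

lemma length_stream (h : History X) : h.stream.length = h.length := by
  simp [History.stream]

lemma queries_le_length (h : History X) : h.queries ≤ h.length := List.countP_le_length

lemma accurate_nil (g : List X → ℝ) (α : ℝ) : History.Accurate g α [] := by
  intro i x z h
  simp at h

lemma Accurate.append_none {g : List X → ℝ} {α : ℝ} {h : History X}
    (hh : History.Accurate g α h) (x : X) : History.Accurate g α (h ++ [(x, none)]) := by
  intro i y z hi
  rcases lt_trichotomy i h.length with hlt | heq | hgt
  · rw [List.getElem?_append_left hlt] at hi
    rw [List.take_append_of_le_length hlt]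
    exact hh i y z hi
  · subst heq
    simp at hi
  · rw [List.getElem?_eq_none (by simp; omega)] at hi
    simp at hi

lemma Accurate.append_some {g : List X → ℝ} {α : ℝ} {h : History X}
    (hh : History.Accurate g α h) {x : X} {z : ℝ}
    (hz : |z - g (h.stream ++ [x])| ≤ α * |g (h.stream ++ [x])|) :
    History.Accurate g α (h ++ [(x, some z)]) := by
  intro i y z' hi
  rcases lt_trichotomy i h.length with hlt | heq | hgt
  · rw [List.getElem?_append_left hlt] at hi
    rw [List.take_append_of_le_length hlt]
    exact hh i y z' hi
  · subst heq
    simp only [List.getElem?_concat_length, Option.some.injEq, Prod.mk.injEq] at hi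
    obtain ⟨rfl, rfl⟩ := hi
    rw [List.take_of_length_le (by simp), stream_append]
    exact hz
  · rw [List.getElem?_eq_none (by simp; omega)] at hi
    simp at hi

end history

/-! ### The reduced game

Here the memory is reduced to the seeds of the sketches in use, which are drawn anew whenever the
number of queries becomes a multiple of `L`. -/

section reduced

variable {X K ι : Type} [Fintype ι] [DecidableEq ι] [Fintype K] [Nonempty K]

/-- One round of the reduced game, where `ρ` is the distribution of the response. -/
def reducedRound (L : ℕ) (ρ : (ι → K) → History X → X → PMF ℝ) (adv : Adversary X)
    (c : (ι → K) × History X) : PMF ((ι → K) × History X) :=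
  (adv c.2).bind fun move =>
  if move.2 = true then
    (ρ c.1 c.2 move.1).bind fun z =>
    if (c.2.queries + 1) % L = 0 then
      (PMF.uniformOfFintype (ι → K)).map fun A => (A, c.2 ++ [(move.1, some z)])
    else PMF.pure (c.1, c.2 ++ [(move.1, some z)])
  else PMF.pure (c.1, c.2 ++ [(move.1, none)])

/-- The reduced game after a number of rounds. -/
def reducedPlay (L : ℕ) (ρ : (ι → K) → History X → X → PMF ℝ) (adv : Adversary X) :
    ℕ → PMF ((ι → K) × History X)
  | 0 => (PMF.uniformOfFintype (ι → K)).map fun A => (A, [])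
  | i + 1 => (reducedPlay L ρ adv i).bind (reducedRound L ρ adv)

/-- The expectation of `f` after the seeds have possibly been renewed. -/
def renew (L k : ℕ) (f : (ι → K) × History X → ℝ≥0∞) (A : ι → K) (h : History X) : ℝ≥0∞ :=
  if (k + 1) % L = 0 then expect (PMF.uniformOfFintype (ι → K)) fun A' => f (A', h) else f (A, h)

lemma expect_reducedRound (L : ℕ) (ρ : (ι → K) → History X → X → PMF ℝ) (adv : Adversary X)
    (c : (ι → K) × History X) (f : (ι → K) × History X → ℝ≥0∞) :
    expect (reducedRound L ρ adv c) f = expect (adv c.2) fun move =>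
      if move.2 = true then
        expect (ρ c.1 c.2 move.1) fun z =>
          renew L c.2.queries f c.1 (c.2 ++ [(move.1, some z)])
      else f (c.1, c.2 ++ [(move.1, none)]) := by
  rw [reducedRound, expect_bind]
  congr 1
  funext move
  by_cases hm : move.2 = true
  · rw [if_pos hm, if_pos hm, expect_bind]
    congr 1
    funext z
    unfold renew
    by_cases hk : (c.2.queries + 1) % L = 0
    · rw [if_pos hk, if_pos hk, expect_map]
    · rw [if_neg hk, if_neg hk, expect_pure]
  · rw [if_neg hm, if_neg hm, expect_pure]

lemma length_of_mem_support_reducedPlay {L : ℕ} {ρ : (ι → K) → History X → X → PMF ℝ}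
    {adv : Adversary X} (i : ℕ) :
    ∀ c ∈ (reducedPlay L ρ adv i).support, c.2.length = i := by
  induction i with
  | zero =>
    intro c hc
    simp only [reducedPlay, PMF.mem_support_map_iff] at hc
    obtain ⟨A, -, rfl⟩ := hc
    rfl
  | succ i ih =>
    intro c hc
    simp only [reducedPlay, reducedRound, PMF.mem_support_bind_iff] at hc
    obtain ⟨c', hc', move, -, hc⟩ := hc
    have := ih c' hc'
    split_ifs at hc with h1 h2
    · simp only [PMF.mem_support_bind_iff, PMF.mem_support_map_iff] at hc
      obtain ⟨z, -, A, -, rfl⟩ := hc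
      simp [this]
    · simp only [PMF.mem_support_bind_iff, PMF.mem_support_pure_iff] at hc
      obtain ⟨z, -, rfl⟩ := hc
      simp [this]
    · rw [PMF.mem_support_pure_iff] at hc
      subst hc
      simp [this]

lemma sq_renew_le (L k : ℕ) (f : (ι → K) × History X → ℝ≥0∞) (A : ι → K) (h : History X) :
    renew L k f A h ^ 2 ≤ renew L k (fun c => f c ^ 2) A h := by
  unfold renew
  split_ifs
  · exact sq_expect_le _ _
  · exact le_rfl

lemma renew_const_mul (L k : ℕ) (W : History X → ℝ≥0∞) (f : (ι → K) × History X → ℝ≥0∞)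
    (A : ι → K) (h : History X) :
    renew L k (fun c => W c.2 * f c) A h = W h * renew L k f A h := by
  unfold renew
  split_ifs
  · exact expect_const_mul _ (W h) fun A' => f (A', h)
  · rfl

/-- Comparison of two reduced games whose response distributions are close in the sense of the
chi-squared divergence; the weight `W` of a history accounts for the divergence so far. -/
lemma sq_expect_reducedPlay_le (L : ℕ) (ρ ρ' : (ι → K) → History X → X → PMF ℝ)
    (adv : Adversary X) (W : History X → ℝ≥0∞) (hnil : 1 ≤ W [])
    (hnone : ∀ h x, W h ≤ W (h ++ [(x, none)]))
    (hsome : ∀ A h x (f : ℝ → ℝ≥0∞), W h * expect (ρ A h x) f ^ 2 ≤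
      expect (ρ' A h x) fun z => W (h ++ [(x, some z)]) * f z ^ 2) (i : ℕ) :
    ∀ f : (ι → K) × History X → ℝ≥0∞, expect (reducedPlay L ρ adv i) f ^ 2 ≤
      expect (reducedPlay L ρ' adv i) fun c => W c.2 * f c ^ 2 := by
  induction i with
  | zero =>
    intro f
    simp only [reducedPlay, expect_map]
    refine (sq_expect_le _ _).trans (expect_mono fun A => ?_)
    exact le_mul_of_one_le_left zero_le hnil
  | succ i ih =>
    intro f
    simp only [reducedPlay, expect_bind]
    refine (ih _).trans (expect_mono fun c => ?_)
    rw [expect_reducedRound, expect_reducedRound]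
    calc W c.2 * _ ^ 2 ≤ W c.2 * _ := mul_le_mul_right (sq_expect_le _ _) _
      _ ≤ _ := ?_
    rw [← expect_const_mul]
    refine expect_mono fun move => ?_
    split_ifs
    · refine (hsome _ _ _ _).trans (expect_mono fun z => ?_)
      rw [renew_const_mul]
      exact mul_le_mul_right (sq_renew_le _ _ _ _ _) _
    · exact mul_le_mul_left (hnone _ _) _

/-- Drawing the seed of the sketch `j` anew. -/
def resample (j : ι) (f : (ι → K) × History X → ℝ≥0∞) (c : (ι → K) × History X) : ℝ≥0∞ :=
  expect (PMF.uniformOfFintype K) fun a => f (Function.update c.1 j a, c.2)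

lemma renew_resample_of_dvd {L k : ℕ} (hk : (k + 1) % L = 0) (j : ι)
    (f : (ι → K) × History X → ℝ≥0∞) (A : ι → K) (h : History X) :
    renew L k (resample j f) A h = renew L k f A h := by
  simp only [renew, if_pos hk, resample]
  exact expect_uniform_update j fun A => f (A, h)

/-- If within epoch `e` the responses do not depend on the seed of the sketch `j`, then that seed
is independent of the history. -/
lemma expect_reducedPlay_resample (L : ℕ) (ρ : (ι → K) → History X → X → PMF ℝ)
    (adv : Adversary X) (e : ℕ) (j : ι)
    (hρ : ∀ A h x a, h.queries / L = e → ρ (Function.update A j a) h x = ρ A h x) (i : ℕ) :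
    ∀ f : (ι → K) × History X → ℝ≥0∞, (∀ c, c.2.queries / L ≠ e → f c = 0) →
      expect (reducedPlay L ρ adv i) (resample j f) = expect (reducedPlay L ρ adv i) f := by
  induction i with
  | zero =>
    intro f _
    simp only [reducedPlay, expect_map, resample]
    exact expect_uniform_update j fun A => f (A, [])
  | succ i ih =>
    intro f hf
    have hf' : ∀ c, c.2.queries / L ≠ e → resample j f c = 0 := by
      intro c hc
      rw [resample, ← expect_const (PMF.uniformOfFintype K) 0]
      congr 1
      funext a
      exact hf _ hc
    simp only [reducedPlay, expect_bind]
    set g := fun c => expect (reducedRound L ρ adv c) f with hg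
    set g₁ : (ι → K) × History X → ℝ≥0∞ := fun c => if c.2.queries / L = e then g c else 0
    set g₂ : (ι → K) × History X → ℝ≥0∞ := fun c => if c.2.queries / L = e then 0 else g c
    have hsplit : g = fun c => g₁ c + g₂ c := by
      funext c
      simp only [g₁, g₂]
      split_ifs <;> simp
    have hleft : ∀ c, expect (reducedRound L ρ adv c) (resample j f) = resample j g₁ c + g₂ c := by
      intro c
      by_cases hc : c.2.queries / L = e
      · have : resample j g₁ c + g₂ c = resample j g c := by
          simp [g₁, g₂, hc, resample]
        rw [this]
        simp only [hg, resample, expect_reducedRound]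
        rw [expect_comm]
        congr 1
        funext move
        split_ifs
        · simp only [hρ _ _ _ _ hc]
          rw [expect_comm]
          congr 1
          funext z
          by_cases hk : (c.2.queries + 1) % L = 0
          · have := renew_resample_of_dvd hk j f c.1 (c.2 ++ [(move.1, some z)])
            refine this.trans ?_
            simp only [renew, if_pos hk, expect_const]
          · simp only [renew, if_neg hk, resample]
        · rfl
      · have : resample j g₁ c + g₂ c = g c := by
          simp [g₁, g₂, hc, resample, expect_const]
        rw [this]
        simp only [hg, expect_reducedRound]
        congr 1
        funext move
        split_ifs
        · congr 1
          funext z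
          by_cases hk : (c.2.queries + 1) % L = 0
          · exact renew_resample_of_dvd hk j f _ _
          · have hne : (c.2.queries + 1) / L ≠ e := by
              rwa [Nat.succ_div_of_not_dvd fun hd => hk (Nat.mod_eq_zero_of_dvd hd)]
            simp only [renew, if_neg hk]
            rw [hf, hf'] <;> simpa only [queries_append_some] using hne
        · rw [hf, hf'] <;> simpa only [queries_append_none] using hc
    simp only [hleft]
    rw [expect_add, ih g₁ fun c hc => if_neg hc, ← expect_add, ← hsplit]

/-- A seed is good for a stream if its sketch votes for the intended candidate and only for
candidates that are accurate. -/
def GoodSeed {Z : Type} (g : List X → ℝ) (α : ℝ) (V : K → List X → Set Z) (val : Z → ℝ)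
    (z₀ : List X → Z) (u : List X) (k : K) : Prop :=
  z₀ u ∈ V k u ∧ ∀ z ∈ V k u, |val z - g u| ≤ α * |g u|

variable {Z : Type} [Fintype Z] [Nonempty Z]

/-- The response to a query, computed from the votes of the sketches in `J`. -/
def answer (b : ℝ≥0∞) (V : K → List X → Set Z) (val : Z → ℝ) (J : Finset ι) (A : ι → K)
    (u : List X) : PMF ℝ :=
  (select b J fun i => V (A i) u).map val

/-- The answers of all sketches, with the sketch `j` ignored in epoch `e`. -/
def answerWithout (b : ℝ≥0∞) (V : K → List X → Set Z) (val : Z → ℝ) (L e : ℕ) (j : ι)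
    (A : ι → K) (h : History X) (x : X) : PMF ℝ :=
  if h.queries / L = e then answer b V val (Finset.univ.erase j) A (h.stream ++ [x])
  else answer b V val Finset.univ A (h.stream ++ [x])

/-- The answers of all sketches. -/
def answerAll (b : ℝ≥0∞) (V : K → List X → Set Z) (val : Z → ℝ)
    (A : ι → K) (h : History X) (x : X) : PMF ℝ :=
  answer b V val Finset.univ A (h.stream ++ [x])

variable (θ : NNReal) (V : K → List X → Set Z) (val : Z → ℝ) (L : ℕ) (adv : Adversary X)

lemma sq_expect_answerAll_le (hL : 0 < L) (e : ℕ) (j : ι) (i : ℕ)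
    (f : (ι → K) × History X → ℝ≥0∞) :
    expect (reducedPlay L (answerAll (1 + θ : NNReal) V val) adv i) f ^ 2 ≤
      expect (reducedPlay L (answerWithout (1 + θ : NNReal) V val L e j) adv i) fun c =>
        ((1 + θ ^ 2 : NNReal) : ℝ≥0∞) ^ (c.2.queries - e * L) * f c ^ 2 := by
  have h1 : (1 : ℝ≥0∞) ≤ ((1 + θ ^ 2 : NNReal) : ℝ≥0∞) := by
    exact_mod_cast le_self_add
  refine sq_expect_reducedPlay_le L _ _ adv
    (fun h => ((1 + θ ^ 2 : NNReal) : ℝ≥0∞) ^ (h.queries - e * L)) ?_ ?_ ?_ i f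
  · exact one_le_pow₀ h1
  · intro h x
    simp only [queries_append_none, le_refl]
  · intro A h x f
    simp only [queries_append_some]
    rw [expect_const_mul]
    unfold answerAll answerWithout
    split_ifs with he
    · have hle : e * L ≤ h.queries := (Nat.le_div_iff_mul_le hL).1 he.ge
      rw [Nat.sub_add_comm hle, pow_succ _ (_ - _), mul_assoc]
      refine mul_le_mul_right ?_ _
      simp only [answer, expect_map]
      exact sq_expect_select_le θ Finset.univ _ j (Finset.mem_univ j) _
    · exact mul_le_mul' (pow_le_pow_right₀ h1 (by omega)) (sq_expect_le _ _)

variable {m : ℕ} {p δ : ℝ≥0∞} {g : List X → ℝ} {α : ℝ} {z₀ : List X → Z}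

/-- The probability that the sketch `j` fails in the next round. -/
def failNext (g : List X → ℝ) (α : ℝ) (V : K → List X → Set Z) (val : Z → ℝ)
    (z₀ : List X → Z) (adv : Adversary X) (j : ι) (c : (ι → K) × History X) : ℝ≥0∞ :=
  expect (adv c.2) fun move =>
    Set.indicator {k | ¬ GoodSeed g α V val z₀ (c.2.stream ++ [move.1]) k} 1 (c.1 j)

lemma expect_failNext_epoch_le (hL : 0 < L)
    (hp : ∀ u : List X, u.length ≤ m → expect (PMF.uniformOfFintype K)
      (Set.indicator {k | ¬ GoodSeed g α V val z₀ u k} 1) ≤ p)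
    (hδ : ((1 + θ ^ 2 : NNReal) : ℝ≥0∞) ^ min L m * p ≤ δ ^ 2) (e : ℕ) (j : ι) {i : ℕ}
    (hi : i < m) :
    expect (reducedPlay L (answerAll (1 + θ : NNReal) V val) adv i) (fun c =>
      if c.2.queries / L = e ∧ c.2.length = i then failNext g α V val z₀ adv j c else 0) ≤ δ := by
  set f : (ι → K) × History X → ℝ≥0∞ := fun c =>
      if c.2.queries / L = e ∧ c.2.length = i then failNext g α V val z₀ adv j c else 0 with hf
  have h1 : (1 : ℝ≥0∞) ≤ ((1 + θ ^ 2 : NNReal) : ℝ≥0∞) := by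
    exact_mod_cast le_self_add
  have hf1 : ∀ c, f c ≤ 1 := by
    intro c
    simp only [hf]
    split_ifs
    · rw [failNext, ← expect_const (adv c.2) 1]
      refine expect_mono fun move => ?_
      exact Set.indicator_le_self' (fun _ _ => zero_le) _
    · exact zero_le
  refine (ENNReal.pow_le_pow_left_iff two_ne_zero).1 ?_
  calc expect (reducedPlay L (answerAll (1 + θ : NNReal) V val) adv i) f ^ 2
      ≤ _ := sq_expect_answerAll_le θ V val L adv hL e j i f
    _ ≤ expect (reducedPlay L (answerWithout (1 + θ : NNReal) V val L e j) adv i) (fun c =>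
          ((1 + θ ^ 2 : NNReal) : ℝ≥0∞) ^ min L m * f c) := by
        refine expect_mono fun c => ?_
        by_cases hc : c.2.queries / L = e ∧ c.2.length = i
        · refine mul_le_mul' (pow_le_pow_right₀ h1 (le_min ?_ ?_)) ?_
          · have : c.2.queries < (e + 1) * L := (Nat.div_lt_iff_lt_mul hL).1 (by omega)
            rw [add_mul] at this
            omega
          · have := queries_le_length c.2
            omega
          · rw [sq]
            exact mul_le_of_le_one_left zero_le (hf1 c)
        · simp [hf, if_neg hc]
    _ = ((1 + θ ^ 2 : NNReal) : ℝ≥0∞) ^ min L m *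
          expect (reducedPlay L (answerWithout (1 + θ : NNReal) V val L e j) adv i)
            (resample j f) := by
        rw [expect_const_mul, expect_reducedPlay_resample L _ adv e j]
        · intro A h x a he
          simp only [answerWithout, if_pos he, answer]
          rw [select_congr]
          intro i hi
          rw [Function.update_of_ne (Finset.ne_of_mem_erase hi)]
        · intro c hc
          simp [hf, hc]
    _ ≤ ((1 + θ ^ 2 : NNReal) : ℝ≥0∞) ^ min L m * p := by
        refine mul_le_mul_right ?_ _
        rw [← expect_const (reducedPlay L (answerWithout (1 + θ : NNReal) V val L e j) adv i) p]
        refine expect_mono fun c => ?_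
        by_cases hc : c.2.queries / L = e ∧ c.2.length = i
        · simp only [resample, hf, if_pos hc, failNext]
          rw [expect_comm, ← expect_const (adv c.2) p]
          refine expect_mono fun move => ?_
          simp only [Function.update_self]
          refine hp _ ?_
          rw [List.length_append, length_stream]
          simp
          omega
        · simp [resample, hf, if_neg hc, expect_const]
    _ ≤ δ ^ 2 := hδ

lemma expect_failNext_le (hL : 0 < L)
    (hp : ∀ u : List X, u.length ≤ m → expect (PMF.uniformOfFintype K)
      (Set.indicator {k | ¬ GoodSeed g α V val z₀ u k} 1) ≤ p)
    (hδ : ((1 + θ ^ 2 : NNReal) : ℝ≥0∞) ^ min L m * p ≤ δ ^ 2) (j : ι) {i : ℕ} (hi : i < m) :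
    expect (reducedPlay L (answerAll (1 + θ : NNReal) V val) adv i)
      (failNext g α V val z₀ adv j) ≤ m * δ := by
  calc expect (reducedPlay L (answerAll (1 + θ : NNReal) V val) adv i)
        (failNext g α V val z₀ adv j)
      ≤ expect (reducedPlay L (answerAll (1 + θ : NNReal) V val) adv i) (fun c =>
        ∑ e ∈ Finset.range m,
          if c.2.queries / L = e ∧ c.2.length = i then failNext g α V val z₀ adv j c else 0) := by
        refine expect_mono_support fun c hc => ?_
        have hlen := length_of_mem_support_reducedPlay i c hc
        have hmem : c.2.queries / L ∈ Finset.range m := by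
          have := queries_le_length c.2
          have := Nat.div_le_self c.2.queries L
          rw [Finset.mem_range]
          omega
        refine le_trans ?_ (Finset.single_le_sum (fun _ _ => zero_le) hmem)
        simp [hlen]
    _ ≤ ∑ _e ∈ Finset.range m, δ := by
        rw [expect_sum]
        exact Finset.sum_le_sum fun e _ => expect_failNext_epoch_le θ V val L adv hL hp hδ e j hi
    _ = m * δ := by simp

/-- In the reduced game, inaccurate responses are unlikely. -/
theorem expect_not_accurate_le (hL : 0 < L)
    (hp : ∀ u : List X, u.length ≤ m → expect (PMF.uniformOfFintype K)
      (Set.indicator {k | ¬ GoodSeed g α V val z₀ u k} 1) ≤ p)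
    (hδ : ((1 + θ ^ 2 : NNReal) : ℝ≥0∞) ^ min L m * p ≤ δ ^ 2) :
    ∀ i ≤ m, expect (reducedPlay L (answerAll (ι := ι) (1 + θ : NNReal) V val) adv i)
      (Set.indicator {c | ¬ History.Accurate g α c.2} 1) ≤
      i * (Fintype.card ι * (m * δ) +
        Fintype.card Z * (((1 + θ : NNReal) : ℝ≥0∞) ^ Fintype.card ι)⁻¹) := by
  have hb : (1 : ℝ≥0∞) ≤ ((1 + θ : NNReal) : ℝ≥0∞) := by
    exact_mod_cast le_self_add
  set bad : Set ((ι → K) × History X) := {c | ¬ History.Accurate g α c.2} with hbad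
  set τ : ℝ≥0∞ := Fintype.card Z * (((1 + θ : NNReal) : ℝ≥0∞) ^ Fintype.card ι)⁻¹ with hτ
  intro i
  induction i with
  | zero =>
    intro _
    simp only [reducedPlay, expect_map]
    rw [← expect_const (PMF.uniformOfFintype (ι → K))
      (((0 : ℕ) : ℝ≥0∞) * (Fintype.card ι * (m * δ) + τ))]
    refine expect_mono fun A => ?_
    simp [hbad, accurate_nil]
  | succ i ih =>
    intro hi
    have hround : ∀ c, expect (reducedRound L (answerAll (1 + θ : NNReal) V val) adv c)
        (bad.indicator 1) ≤
        bad.indicator 1 c + (∑ j, failNext g α V val z₀ adv j c + τ) := by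
      intro c
      by_cases hc : c ∈ bad
      · rw [Set.indicator_of_mem hc]
        refine le_trans ?_ le_self_add
        refine le_trans (expect_mono (g := fun _ => 1) fun c => ?_) (expect_const _ _).le
        exact Set.indicator_le_self' (fun _ _ => zero_le) _
      · have hacc : History.Accurate g α c.2 := not_not.1 hc
        rw [Set.indicator_of_notMem hc, zero_add, expect_reducedRound]
        simp only [failNext]
        rw [← expect_sum, ← expect_const (adv c.2) τ, ← expect_add]
        refine expect_mono fun move => ?_
        split_ifs
        · set u := c.2.stream ++ [move.1] with hu
          by_cases hgood : ∀ j, GoodSeed g α V val z₀ u (c.1 j)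
          · refine le_trans ?_ le_add_self
            set B : Set Z := {z | ¬ |val z - g u| ≤ α * |g u|}
            have := expect_select_indicator_le hb ENNReal.coe_ne_top (Finset.univ : Finset ι)
              (fun j => V (c.1 j) u) (z₀ u) (fun j _ => (hgood j).1) B
              (fun z hz j _ hzj => hz ((hgood j).2 z hzj))
            rw [Finset.card_univ] at this
            refine le_trans ?_ this
            simp only [answerAll, answer, expect_map]
            refine expect_mono fun z => ?_
            by_cases hz : z ∈ B
            · rw [Set.indicator_of_mem hz]
              unfold renew
              split_ifs
              · refine le_trans (expect_mono (g := fun _ => 1) fun c => ?_) (expect_const _ _).le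
                exact Set.indicator_le_self' (fun _ _ => zero_le) _
              · exact Set.indicator_le_self' (fun _ _ => zero_le) _
            · have hacc' := Accurate.append_some hacc (x := move.1) (not_not.1 hz)
              simp [renew, hbad, hacc', expect_const]
          · push Not at hgood
            obtain ⟨j, hj⟩ := hgood
            refine le_trans (b := 1) ?_ (le_trans ?_ le_self_add)
            · refine le_trans (expect_mono (g := fun _ => 1) fun z => ?_) (expect_const _ _).le
              unfold renew
              split_ifs
              · refine le_trans (expect_mono (g := fun _ => 1) fun c => ?_) (expect_const _ _).le
                exact Set.indicator_le_self' (fun _ _ => zero_le) _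
              · exact Set.indicator_le_self' (fun _ _ => zero_le) _
            · refine le_trans ?_ (Finset.single_le_sum (fun _ _ => zero_le) (Finset.mem_univ j))
              rw [Set.indicator_of_mem (by exact hj)]
              rfl
        · have hacc' := Accurate.append_none hacc move.1
          simp [hbad, hacc']
    simp only [reducedPlay, expect_bind]
    refine (expect_mono hround).trans ?_
    rw [expect_add, expect_add, expect_sum, expect_const]
    have hsum : ∑ j : ι, expect (reducedPlay L (answerAll (1 + θ : NNReal) V val) adv i)
        (failNext g α V val z₀ adv j) ≤ Fintype.card ι * (m * δ) := by
      refine (Finset.sum_le_sum fun j _ =>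
        expect_failNext_le θ V val L adv hL hp hδ j (by omega)).trans ?_
      simp
    calc _ ≤ i * (Fintype.card ι * (m * δ) + τ) + (Fintype.card ι * (m * δ) + τ) :=
          add_le_add (ih (by omega)) (add_le_add_left hsum _)
      _ = _ := by push_cast; ring

end reduced

end ASA

end

noncomputable section

namespace ASA

/-! ### The algorithm

The memory holds the seeds and counters of the sketches in use, the seeds of the next generation
of sketches with counters for the part of the stream that came after their choice, and the bits of
advice received so far, which describe the contribution of the earlier part of the stream. -/

section algorithm

variable {X K G Z ι : Type}

/-- A linear sketch of a stream. -/
def sketch [AddCommGroup G] (sk : K → X → G) (A : ι → K) (u : List X) (j : ι) : G :=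
  (u.map (sk (A j))).sum

lemma sketch_append [AddCommGroup G] (sk : K → X → G) (A : ι → K) (u : List X) (x : X) :
    sketch sk A (u ++ [x]) = fun j => sketch sk A u j + sk (A j) x := by
  funext j
  simp [sketch]

/-- The memory content of the algorithm. -/
structure Memory (K G ι : Type) (N : ℕ) where
  /-- seeds of the sketches in use -/
  seed : ι → K
  /-- counters of the sketches in use -/
  counter : ι → G
  /-- seeds of the next generation of sketches -/
  nextSeed : ι → K
  /-- counters of the next generation of sketches -/
  nextCounter : ι → G
  /-- number of bits of advice received since the choice of the next generation -/
  pos : Fin N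
  /-- the bits of advice received -/
  bits : Fin N → Bool

/-- The memory as a product. -/
def Memory.equivProd (K G ι : Type) (N : ℕ) : Memory K G ι N ≃
    (ι → K) × (ι → G) × (ι → K) × (ι → G) × Fin N × (Fin N → Bool) where
  toFun s := (s.seed, s.counter, s.nextSeed, s.nextCounter, s.pos, s.bits)
  invFun t := ⟨t.1, t.2.1, t.2.2.1, t.2.2.2.1, t.2.2.2.2.1, t.2.2.2.2.2⟩
  left_inv _ := rfl
  right_inv _ := rfl

/-- A coding of an arbitrary memory type by bits. -/
structure Coding (M : Type) (S : ℕ) where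
  /-- the code of a memory content -/
  enc : M → Fin S → Bool
  /-- the memory content with a given code -/
  dec : (Fin S → Bool) → M
  /-- decoding inverts encoding -/
  dec_enc : ∀ s, dec (enc s) = s

lemma exists_coding {M : Type} [Fintype M] [Nonempty M] {S : ℕ} (h : Fintype.card M ≤ 2 ^ S) :
    Nonempty (Coding M S) := by
  have : Nonempty (M ↪ (Fin S → Bool)) := by
    rw [Function.Embedding.nonempty_iff_card_le]
    simpa using h
  obtain ⟨f⟩ := this
  exact ⟨⟨f, Function.invFun f, Function.leftInverse_invFun f.injective⟩⟩

variable {N S : ℕ} [AddCommGroup G]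

/-- The memory content after an update. -/
def Memory.update (sk : K → X → G) (s : Memory K G ι N) (x : X) : Memory K G ι N :=
  { s with
    counter := fun j => s.counter j + sk (s.seed j) x
    nextCounter := fun j => s.nextCounter j + sk (s.nextSeed j) x }

/-- The memory content is consistent with the stream and the number `k` of bits of advice. -/
structure Memory.Valid (E : (ι → G) → Fin N → Bool) (sk : K → X → G)
    (s : Memory K G ι N) (u : List X) (k : ℕ) : Prop where
  counter_eq : s.counter = sketch sk s.seed u
  pos_eq : s.pos.1 = k % N
  bits_eq : ∀ q < s.pos,
    s.bits q = E (fun j => sketch sk s.nextSeed u j - s.nextCounter j) q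

lemma Memory.Valid.update {E : (ι → G) → Fin N → Bool} {sk : K → X → G} {k : ℕ}
    {s : Memory K G ι N} {u : List X} (hs : s.Valid E sk u k) (x : X) :
    (s.update sk x).Valid E sk (u ++ [x]) k where
  counter_eq := by
    simp only [Memory.update, sketch_append, hs.counter_eq]
  pos_eq := hs.pos_eq
  bits_eq q hq := by
    simp only [Memory.update, sketch_append, add_sub_add_right_eq_sub]
    exact hs.bits_eq q hq

lemma succ_mod_mul_ne_zero {k η N : ℕ} (hk : (k + 1) % η ≠ 0) : (k + 1) % (η * N) ≠ 0 :=
  fun h => hk (Nat.mod_eq_zero_of_dvd ((Dvd.intro N rfl).trans (Nat.dvd_of_mod_eq_zero h)))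

lemma succ_mod_mul_eq_zero_iff {k η N : ℕ} (hη : 0 < η) (hN : 0 < N) (hk : (k + 1) % η = 0) :
    (k + 1) % (η * N) = 0 ↔ ¬ k / η % N + 1 < N := by
  have h1 : k + 1 = η * (k / η + 1) := by
    rw [← Nat.succ_div_of_dvd (Nat.dvd_of_mod_eq_zero hk),
      Nat.mul_div_cancel' (Nat.dvd_of_mod_eq_zero hk)]
  rw [h1, ← Nat.dvd_iff_mod_eq_zero, Nat.mul_dvd_mul_iff_left hη]
  have h2 : k / η + 1 = N * (k / η / N) + (k / η % N + 1) := by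
    rw [← add_assoc, Nat.div_add_mod]
  rw [h2, ← Nat.dvd_add_iff_right (Dvd.intro _ rfl)]
  have h3 := Nat.mod_lt (k / η) hN
  constructor
  · intro hd
    have := Nat.le_of_dvd (by omega) hd
    omega
  · intro hlt
    have : k / η % N + 1 = N := by omega
    rw [this]

variable [Fintype ι] [DecidableEq ι] [Fintype K] [Nonempty K] [Fintype Z] [Nonempty Z] [NeZero N]

/-- The new memory content after the bit of advice `a` has been received. -/
def Memory.receive (D : (Fin N → Bool) → ι → G) (s : Memory K G ι N) (a : Bool) :
    PMF (Memory K G ι N) :=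
  if h : s.pos.1 + 1 < N then
    PMF.pure { s with pos := ⟨s.pos.1 + 1, h⟩, bits := Function.update s.bits s.pos a }
  else
    (PMF.uniformOfFintype (ι → K)).map fun A =>
      { seed := s.nextSeed
        counter := fun j => s.nextCounter j + D (Function.update s.bits s.pos a) j
        nextSeed := A
        nextCounter := 0
        pos := 0
        bits := s.bits }

lemma Memory.Valid.receive {E : (ι → G) → Fin N → Bool} {D : (Fin N → Bool) → ι → G}
    (hD : ∀ v, D (E v) = v) {sk : K → X → G} {k : ℕ} {s : Memory K G ι N} {u : List X}
    (hs : s.Valid E sk u k) {s' : Memory K G ι N}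
    (hs' : s' ∈ (s.receive D
      (E (fun j => sketch sk s.nextSeed u j - s.nextCounter j) s.pos)).support) :
    s'.Valid E sk u (k + 1) := by
  have hN : 0 < N := Nat.pos_of_ne_zero (NeZero.ne N)
  have hbits : ∀ q : Fin N, q.1 ≤ s.pos.1 → Function.update s.bits s.pos
      (E (fun j => sketch sk s.nextSeed u j - s.nextCounter j) s.pos) q =
      E (fun j => sketch sk s.nextSeed u j - s.nextCounter j) q := by
    intro q hq
    rcases eq_or_ne q s.pos with rfl | hne
    · simp
    · rw [Function.update_of_ne hne]
      exact hs.bits_eq q (lt_of_le_of_ne hq hne)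
  have hmod : (k + 1) % N = (s.pos.1 + 1) % N := by
    rw [hs.pos_eq, Nat.mod_add_mod]
  unfold Memory.receive at hs'
  split_ifs at hs' with h
  · rw [PMF.mem_support_pure_iff] at hs'
    subst hs'
    refine ⟨hs.counter_eq, ?_, fun q hq => hbits q ?_⟩
    · rw [hmod, Nat.mod_eq_of_lt h]
    · exact Nat.lt_succ_iff.1 hq
  · rw [PMF.mem_support_map_iff] at hs'
    obtain ⟨A, -, rfl⟩ := hs'
    refine ⟨?_, ?_, fun q hq => absurd hq (by simp)⟩
    · have : Function.update s.bits s.pos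
          (E (fun j => sketch sk s.nextSeed u j - s.nextCounter j) s.pos) =
          E (fun j => sketch sk s.nextSeed u j - s.nextCounter j) :=
        funext fun q => hbits q (by have := q.2; omega)
      funext j
      simp only [this, hD, add_sub_cancel]
    · have := s.pos.2
      rw [hmod, show s.pos.1 + 1 = N by omega, Nat.mod_self]
      rfl

/-- The streaming algorithm. Here `E` codes the counters of a generation of sketches by bits, and
`D` decodes them. -/
def sketchAlgorithm (cd : Coding (Memory K G ι N) S) (E : (ι → G) → Fin N → Bool)
    (D : (Fin N → Bool) → ι → G) (sk : K → X → G) (b : ℝ≥0∞) (vote : G → Set Z) (val : Z → ℝ) :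
    Algorithm X S where
  init := (PMF.uniformOfFintype (ι → K)).bind fun A =>
    (PMF.uniformOfFintype (ι → K)).map fun A' =>
      cd.enc ⟨A, 0, A', 0, 0, fun _ => false⟩
  update s x := PMF.pure (cd.enc ((cd.dec s).update sk x))
  respond s := (select b Finset.univ fun j => vote ((cd.dec s).counter j)).map fun z => (s, val z)
  predicate s u :=
    E (fun j => sketch sk (cd.dec s).nextSeed u j - (cd.dec s).nextCounter j) (cd.dec s).pos
  receive s a := ((cd.dec s).receive D a).map cd.enc

/-- What remains of a configuration when all but the seeds is forgotten. -/
def project (cd : Coding (Memory K G ι N) S) (c : (Fin S → Bool) × History X) :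
    (ι → K) × (ι → K) × History X :=
  ((cd.dec c.1).seed, (cd.dec c.1).nextSeed, c.2)

variable (cd : Coding (Memory K G ι N) S) (E : (ι → G) → Fin N → Bool)
    (D : (Fin N → Bool) → ι → G) (sk : K → X → G) (b : ℝ≥0∞) (vote : G → Set Z) (val : Z → ℝ)
    (η : ℕ) (adv : Adversary X)

/-- The configuration is consistent. -/
def ValidConfig (c : (Fin S → Bool) × History X) : Prop :=
  (cd.dec c.1).Valid E sk c.2.stream (c.2.queries / η)

/-- The votes of a single sketch. -/
def votes (k : K) (u : List X) : Set Z := vote (u.map (sk k)).sum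

lemma validConfig_of_mem_support_playRound (hD : ∀ v, D (E v) = v)
    {c c' : (Fin S → Bool) × History X} (hc : ValidConfig cd E sk η c)
    (hc' : c' ∈ (playRound η (sketchAlgorithm cd E D sk b vote val) adv c).support) :
    ValidConfig cd E sk η c' := by
  simp only [playRound, sketchAlgorithm, PMF.pure_bind, PMF.mem_support_bind_iff] at hc'
  obtain ⟨move, -, hc'⟩ := hc'
  have hu := Memory.Valid.update hc move.1
  split_ifs at hc' with h1
  · simp only [PMF.mem_support_bind_iff, PMF.mem_support_map_iff] at hc'
    obtain ⟨_, ⟨z, -, rfl⟩, hc'⟩ := hc'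
    rw [queries_append_some] at hc'
    split_ifs at hc' with h2
    · simp only [PMF.mem_support_bind_iff, PMF.mem_support_map_iff, PMF.mem_support_pure_iff,
        cd.dec_enc, stream_append] at hc'
      obtain ⟨_, ⟨s, hs, rfl⟩, rfl⟩ := hc'
      simp only [ValidConfig, cd.dec_enc, stream_append, queries_append_some]
      rw [Nat.succ_div_of_dvd (Nat.dvd_of_mod_eq_zero h2)]
      exact hu.receive hD hs
    · rw [PMF.mem_support_pure_iff] at hc'
      subst hc'
      simp only [ValidConfig, cd.dec_enc, stream_append, queries_append_some]
      rwa [Nat.succ_div_of_not_dvd fun hd => h2 (Nat.mod_eq_zero_of_dvd hd)]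
  · rw [PMF.mem_support_pure_iff] at hc'
    subst hc'
    simp only [ValidConfig, cd.dec_enc, stream_append, queries_append_none]
    exact hu

lemma expect_receive (s : Memory K G ι N) (a : Bool) (F : (ι → K) → (ι → K) → ℝ≥0∞) :
    expect (s.receive D a) (fun s' => F s'.seed s'.nextSeed) =
      if s.pos.1 + 1 < N then F s.seed s.nextSeed
      else expect (PMF.uniformOfFintype (ι → K)) fun A => F s.nextSeed A := by
  unfold Memory.receive
  split_ifs
  · rw [expect_pure]
  · rw [expect_map]

lemma expect_playRound (hη : 0 < η) {c : (Fin S → Bool) × History X}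
    (hc : ValidConfig cd E sk η c) (F : (ι → K) × (ι → K) × History X → ℝ≥0∞) :
    expect (playRound η (sketchAlgorithm cd E D sk b vote val) adv c)
        (fun c' => F (project cd c')) =
      expect (adv c.2) fun move =>
        if move.2 = true then
          expect (answerAll b (votes sk vote) val (cd.dec c.1).seed c.2 move.1) fun z =>
            if (c.2.queries + 1) % (η * N) = 0 then
              expect (PMF.uniformOfFintype (ι → K)) fun A =>
                F ((cd.dec c.1).nextSeed, A, c.2 ++ [(move.1, some z)])
            else F ((cd.dec c.1).seed, (cd.dec c.1).nextSeed, c.2 ++ [(move.1, some z)])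
        else F ((cd.dec c.1).seed, (cd.dec c.1).nextSeed, c.2 ++ [(move.1, none)]) := by
  have hN : 0 < N := Nat.pos_of_ne_zero (NeZero.ne N)
  simp only [playRound, sketchAlgorithm, PMF.pure_bind, expect_bind]
  congr 1
  funext move
  by_cases h1 : move.2 = true
  · rw [if_pos h1, if_pos h1]
    have hcounter := (Memory.Valid.update hc move.1).counter_eq
    rw [expect_bind, expect_map, answerAll, answer, expect_map]
    simp only [cd.dec_enc, hcounter]
    change expect (select b Finset.univ fun j =>
      votes sk vote ((cd.dec c.1).seed j) (c.2.stream ++ [move.1])) _ = _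
    congr 1
    funext z
    rw [queries_append_some]
    by_cases h2 : (c.2.queries + 1) % η = 0
    · rw [if_pos h2, expect_bind, expect_map]
      simp only [expect_pure, project, cd.dec_enc]
      rw [expect_receive D _ _ fun A A' => F (A, A', c.2 ++ [(move.1, some (val z))])]
      have hpos : ((cd.dec c.1).update sk move.1).pos.1 = c.2.queries / η % N := hc.pos_eq
      rw [hpos]
      have hiff := succ_mod_mul_eq_zero_iff hη hN h2
      by_cases h3 : c.2.queries / η % N + 1 < N
      · rw [if_pos h3, if_neg (fun h => hiff.1 h h3)]
        rfl
      · rw [if_neg h3, if_pos (hiff.2 h3)]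
        rfl
    · rw [if_neg h2, if_neg (succ_mod_mul_ne_zero h2), expect_pure]
      simp only [project, cd.dec_enc]
      rfl
  · rw [if_neg h1, if_neg h1, expect_pure]
    simp only [project, cd.dec_enc]
    rfl

lemma validConfig_of_mem_support_play (hD : ∀ v, D (E v) = v) (i : ℕ) :
    ∀ c ∈ (play η (sketchAlgorithm cd E D sk b vote val) adv i).support,
      ValidConfig cd E sk η c := by
  induction i with
  | zero =>
    intro c hc
    simp only [play, sketchAlgorithm, PMF.mem_support_bind_iff, PMF.mem_support_map_iff,
      PMF.mem_support_pure_iff] at hc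
    obtain ⟨_, ⟨A, -, A', -, rfl⟩, rfl⟩ := hc
    simp only [ValidConfig, cd.dec_enc]
    refine ⟨?_, ?_, fun q hq => absurd hq (by simp)⟩
    · funext j
      simp [sketch, History.stream]
    · simp [History.queries]
  | succ i ih =>
    intro c hc
    rw [play, PMF.mem_support_bind_iff] at hc
    obtain ⟨c₀, hc₀, hc⟩ := hc
    exact validConfig_of_mem_support_playRound cd E D sk b vote val η adv hD (ih c₀ hc₀) hc

/-- In the game, the seeds in use and the history are distributed as in the reduced game, and the
next seeds are independent of them. -/
theorem expect_play (hη : 0 < η) (hD : ∀ v, D (E v) = v) (i : ℕ) :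
    ∀ F : (ι → K) × (ι → K) × History X → ℝ≥0∞,
      expect (play η (sketchAlgorithm cd E D sk b vote val) adv i) (fun c => F (project cd c)) =
      expect (reducedPlay (η * N) (answerAll b (votes sk vote) val) adv i) fun c =>
        expect (PMF.uniformOfFintype (ι → K)) fun A => F (c.1, A, c.2) := by
  induction i with
  | zero =>
    intro F
    simp only [play, reducedPlay, sketchAlgorithm, expect_bind, expect_map, expect_pure, project,
      cd.dec_enc]
  | succ i ih =>
    intro F
    rw [play, expect_bind, expect_congr fun c hc => expect_playRound cd E D sk b vote val η adv hη
      (validConfig_of_mem_support_play cd E D sk b vote val η adv hD i c hc) F]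
    rw [reducedPlay, expect_bind]
    refine (ih fun c => expect (adv c.2.2) fun move =>
        if move.2 = true then
          expect (answerAll b (votes sk vote) val c.1 c.2.2 move.1) fun z =>
            if (c.2.2.queries + 1) % (η * N) = 0 then
              expect (PMF.uniformOfFintype (ι → K)) fun A =>
                F (c.2.1, A, c.2.2 ++ [(move.1, some z)])
            else F (c.1, c.2.1, c.2.2 ++ [(move.1, some z)])
        else F (c.1, c.2.1, c.2.2 ++ [(move.1, none)])).trans ?_
    congr 1
    funext c
    rw [expect_reducedRound]
    dsimp only
    rw [expect_comm]
    congr 1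
    funext move
    by_cases h1 : move.2 = true
    · simp only [if_pos h1]
      rw [expect_comm]
      congr 1
      funext z
      unfold renew
      by_cases h2 : (c.2.queries + 1) % (η * N) = 0
      · simp only [if_pos h2]
      · simp only [if_neg h2]
    · simp only [if_neg h1]

end algorithm

lemma isRobust_of_expect_le {X : Type} {S : ℕ} {alg : Algorithm X S} {g : List X → ℝ} {η m : ℕ}
    {α β : ℝ} (hβ : 0 ≤ β)
    (h : ∀ adv : Adversary X, expect (play η alg adv m)
      (Set.indicator {c | ¬ History.Accurate g α c.2} 1) ≤ ENNReal.ofReal β) (T : ℕ) :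
    alg.IsRobust g η m T α β := by
  intro adv _
  rw [ENNReal.ofReal_sub 1 hβ, ENNReal.ofReal_one, tsub_le_iff_right, ← expect_indicator]
  refine le_trans ?_ (add_le_add_right (h adv) _)
  rw [← expect_add, ← expect_const (play η alg adv m) 1]
  refine expect_mono fun c => ?_
  by_cases hc : History.Accurate g α c.2 <;> simp [hc]

/-- A linear sketch which votes correctly with high probability on every short stream yields a
robust algorithm in the game with advice. -/
theorem exists_isRobust {X K G Z : Type} [Fintype K] [Nonempty K] [AddCommGroup G] [Fintype G]
    [Fintype Z] [Nonempty Z] (sk : K → X → G) (vote : G → Set Z) (val : Z → ℝ) (z₀ : List X → Z)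
    {g : List X → ℝ} {η m r a b : ℕ} {α β : ℝ} {θ : NNReal} {p δ : ℝ≥0∞} (hη : 0 < η)
    (hr : 0 < r) (hb : 0 < b) (hβ : 0 ≤ β) (hK : Fintype.card K ≤ 2 ^ a)
    (hG : Fintype.card G ≤ 2 ^ b)
    (hp : ∀ u : List X, u.length ≤ m → expect (PMF.uniformOfFintype K)
      (Set.indicator {k | ¬ GoodSeed g α (votes sk vote) val z₀ u k} 1) ≤ p)
    (hδ : ((1 + θ ^ 2 : NNReal) : ℝ≥0∞) ^ min (η * (r * b)) m * p ≤ δ ^ 2)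
    (hfail : m * (r * (m * δ) + Fintype.card Z * (((1 + θ : NNReal) : ℝ≥0∞) ^ r)⁻¹) ≤
      ENNReal.ofReal β) :
    ∃ alg : Algorithm X (4 * r * (a + b)), ∀ T, alg.IsRobust g η m T α β := by
  classical
  have hN : 0 < r * b := Nat.mul_pos hr hb
  have : NeZero (r * b) := ⟨hN.ne'⟩
  have : Fintype (Memory K G (Fin r) (r * b)) := Fintype.ofEquiv _ (Memory.equivProd _ _ _ _).symm
  have : Nonempty (Memory K G (Fin r) (r * b)) :=
    ⟨⟨fun _ => Classical.arbitrary K, 0, fun _ => Classical.arbitrary K, 0, 0, fun _ => false⟩⟩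
  have hKr : Fintype.card K ^ r ≤ 2 ^ (r * a) := by
    rw [mul_comm, pow_mul]
    exact Nat.pow_le_pow_left hK r
  have hGr : Fintype.card G ^ r ≤ 2 ^ (r * b) := by
    rw [mul_comm, pow_mul]
    exact Nat.pow_le_pow_left hG r
  have hcard : Fintype.card (Memory K G (Fin r) (r * b)) ≤ 2 ^ (4 * r * (a + b)) := by
    rw [Fintype.card_congr (Memory.equivProd _ _ _ _)]
    simp only [Fintype.card_prod, Fintype.card_fun, Fintype.card_fin, Fintype.card_bool]
    calc _ ≤ 2 ^ (r * a) * (2 ^ (r * b) * (2 ^ (r * a) * (2 ^ (r * b) *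
          (2 ^ (r * b) * 2 ^ (r * b))))) := by
          gcongr
          exact Nat.lt_two_pow_self.le
      _ = 2 ^ (r * a + (r * b + (r * a + (r * b + (r * b + r * b))))) := by
          simp only [pow_add]
      _ ≤ 2 ^ (4 * r * (a + b)) := Nat.pow_le_pow_right two_pos (by nlinarith [Nat.zero_le (r * a)])
  obtain ⟨cd⟩ := exists_coding hcard
  obtain ⟨cG⟩ : Nonempty (Coding (Fin r → G) (r * b)) :=
    exists_coding (by simpa using hGr)
  refine ⟨sketchAlgorithm cd cG.enc cG.dec sk (1 + θ : NNReal) vote val,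
    isRobust_of_expect_le hβ fun adv => le_trans ?_ hfail⟩
  have h1 := expect_play cd cG.enc cG.dec sk (1 + θ : NNReal) vote val η adv hη cG.dec_enc m
    fun c => Set.indicator {h | ¬ History.Accurate g α h} 1 c.2.2
  have h2 := expect_not_accurate_le (ι := Fin r) θ (votes sk vote) val (η * (r * b)) adv
    (Nat.mul_pos hη hN) hp hδ m le_rfl
  simp only [expect_const] at h1
  rw [Fintype.card_fin] at h2
  refine le_trans (le_of_eq ?_) h2
  exact h1

end ASA

end

noncomputable section

namespace ASA

/-! ### Sign vectors with four-wise uncorrelated entries -/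

section sign

/-- A finite field of characteristic two has a nontrivial additive character with values `± 1`. -/
lemma exists_signCharacter (F : Type) [Field F] [Fintype F] [CharP F 2] :
    ∃ ψ : AddChar F ℤ, ψ.IsPrimitive ∧ ∀ x, ψ x * ψ x = 1 := by
  let _ : Algebra (ZMod 2) F := ZMod.algebra F 2
  obtain ⟨φ, hφ⟩ : ∃ φ : F →ₗ[ZMod 2] ZMod 2, φ 1 = 1 :=
    Module.Projective.exists_dual_eq_one (ZMod 2) one_ne_zero
  let ψ : AddChar F ℤ :=
    { toFun := fun x => if φ x = 0 then 1 else -1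
      map_zero_eq_one' := by simp
      map_add_eq_mul' := by
        intro x y
        rw [map_add]
        generalize φ x = a
        generalize φ y = b
        revert a b
        decide }
  refine ⟨ψ, AddChar.IsPrimitive.of_ne_one ?_, ?_⟩
  · intro h
    have : ψ 1 = 1 := by rw [h]; rfl
    simp [ψ, hφ] at this
  · intro x
    change (if φ x = 0 then (1 : ℤ) else -1) * (if φ x = 0 then (1 : ℤ) else -1) = 1
    split_ifs <;> simp

variable {F : Type} [Field F]

/-- The entry at `y` of the sign vector with seed `s`. -/
def sgn (ψ : AddChar F ℤ) (s : F × F) (y : F) : ℤ := ψ (s.1 * y + s.2 * y ^ 3)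

lemma sgn_mul_self {ψ : AddChar F ℤ} (hψ : ∀ x, ψ x * ψ x = 1) (s : F × F) (y : F) :
    sgn ψ s y * sgn ψ s y = 1 := hψ _

lemma eq_or_eq_or_eq_of_sum_eq_zero [CharP F 2] {a b c d : F} (h1 : a + b + c + d = 0)
    (h3 : a ^ 3 + b ^ 3 + c ^ 3 + d ^ 3 = 0) :
    (a = b ∧ c = d) ∨ (a = c ∧ b = d) ∨ (a = d ∧ b = c) := by
  have hd : d = a + b + c := by
    rw [add_eq_zero_iff_eq_neg, CharTwo.neg_eq] at h1
    exact h1.symm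
  have h2 : (2 : F) = 0 := CharTwo.two_eq_zero
  have : (a + b) * ((b + c) * (c + a)) = 0 := by
    rw [hd] at h3
    linear_combination h3 - h2 * (a ^ 3 + b ^ 3 + c ^ 3 + (a + b) * (b + c) * (c + a))
  have key : ∀ x y : F, x + y = 0 → x = y := fun x y h => by
    rwa [add_eq_zero_iff_eq_neg, CharTwo.neg_eq] at h
  rcases mul_eq_zero.1 this with h | h
  · have := key _ _ h
    subst this
    left
    refine ⟨rfl, ?_⟩
    rw [hd]
    linear_combination -a * h2
  rcases mul_eq_zero.1 h with h | h
  · have := key _ _ h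
    subst this
    right; right
    refine ⟨?_, rfl⟩
    rw [hd]
    linear_combination -b * h2
  · have := key _ _ h
    subst this
    right; left
    refine ⟨rfl, ?_⟩
    rw [hd]
    linear_combination -c * h2

variable [Fintype F]

lemma sum_character {ψ : AddChar F ℤ} (hψ : ψ.IsPrimitive) {a b : F} (hab : a ≠ 0 ∨ b ≠ 0) :
    ∑ s : F × F, ψ (s.1 * a + s.2 * b) = 0 := by
  classical
  rw [Fintype.sum_prod_type]
  simp only [AddChar.map_add_eq_mul, ← Finset.mul_sum, ← Finset.sum_mul]
  rw [AddChar.sum_mulShift a hψ, AddChar.sum_mulShift b hψ]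
  rcases hab with h | h <;> simp [h]

variable [CharP F 2]

lemma sum_sgn_mul_sgn {ψ : AddChar F ℤ} (hψ : ψ.IsPrimitive) {a b : F} (hab : a ≠ b) :
    ∑ s : F × F, sgn ψ s a * sgn ψ s b = 0 := by
  have h : ∀ s : F × F, sgn ψ s a * sgn ψ s b = ψ (s.1 * (a + b) + s.2 * (a ^ 3 + b ^ 3)) := by
    intro s
    rw [sgn, sgn, ← AddChar.map_add_eq_mul]
    congr 1
    ring
  simp only [h]
  refine sum_character hψ (Or.inl fun h0 => hab ?_)
  rw [add_eq_zero_iff_eq_neg, CharTwo.neg_eq] at h0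
  exact h0

lemma sum_sgn_four {ψ : AddChar F ℤ} (hψ : ψ.IsPrimitive) {a b c d : F}
    (h : ¬ ((a = b ∧ c = d) ∨ (a = c ∧ b = d) ∨ (a = d ∧ b = c))) :
    ∑ s : F × F, sgn ψ s a * sgn ψ s b * (sgn ψ s c * sgn ψ s d) = 0 := by
  have h' : ∀ s : F × F, sgn ψ s a * sgn ψ s b * (sgn ψ s c * sgn ψ s d) =
      ψ (s.1 * (a + b + c + d) + s.2 * (a ^ 3 + b ^ 3 + c ^ 3 + d ^ 3)) := by
    intro s
    rw [sgn, sgn, sgn, sgn, ← AddChar.map_add_eq_mul, ← AddChar.map_add_eq_mul,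
      ← AddChar.map_add_eq_mul]
    congr 1
    ring
  simp only [h']
  refine sum_character hψ ?_
  by_contra hcon
  push Not at hcon
  exact h (eq_or_eq_or_eq_of_sum_eq_zero hcon.1 hcon.2)

variable {ι : Type} [Fintype ι] (y : ι → F)

/-- The inner product of a vector with a sign vector. -/
def signSum (ψ : AddChar F ℤ) (y : ι → F) (v : ι → ℤ) (s : F × F) : ℤ :=
  ∑ a, sgn ψ s (y a) * v a

lemma sum_signSum_sq {ψ : AddChar F ℤ} (hψ : ψ.IsPrimitive) (hψ' : ∀ x, ψ x * ψ x = 1)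
    (hy : Function.Injective y) (v : ι → ℤ) :
    ∑ s, signSum ψ y v s ^ 2 = Fintype.card (F × F) * ∑ a, v a ^ 2 := by
  classical
  calc ∑ s, signSum ψ y v s ^ 2
      = ∑ s : F × F, ∑ a, ∑ b, v a * v b * (sgn ψ s (y a) * sgn ψ s (y b)) := by
        refine Finset.sum_congr rfl fun s _ => ?_
        rw [signSum, sq, Finset.sum_mul_sum]
        exact Finset.sum_congr rfl fun a _ => Finset.sum_congr rfl fun b _ => by ring
    _ = ∑ a, ∑ b, v a * v b * ∑ s : F × F, sgn ψ s (y a) * sgn ψ s (y b) := by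
        rw [Finset.sum_comm]
        refine Finset.sum_congr rfl fun a _ => ?_
        rw [Finset.sum_comm]
        exact Finset.sum_congr rfl fun b _ => (Finset.mul_sum _ _ _).symm
    _ = ∑ a, Fintype.card (F × F) * v a ^ 2 := by
        refine Finset.sum_congr rfl fun a _ => ?_
        rw [Finset.sum_eq_single a]
        · simp only [sgn_mul_self hψ', Finset.sum_const, Finset.card_univ, nsmul_eq_mul]
          ring
        · intro b _ hb
          rw [sum_sgn_mul_sgn hψ (hy.ne hb.symm), mul_zero]
        · simp
    _ = _ := (Finset.mul_sum _ _ _).symm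

lemma sum_signSum_four_le {ψ : AddChar F ℤ} (hψ : ψ.IsPrimitive) (hψ' : ∀ x, ψ x * ψ x = 1)
    (hy : Function.Injective y) (v : ι → ℤ) :
    ∑ s, signSum ψ y v s ^ 4 ≤ 3 * Fintype.card (F × F) * (∑ a, v a ^ 2) ^ 2 := by
  classical
  let q : ℤ := Fintype.card (F × F)
  have hq : 0 ≤ q := Int.natCast_nonneg _
  have hterm : ∀ a b c d, v a * v b * (v c * v d) *
      ∑ s : F × F, sgn ψ s (y a) * sgn ψ s (y b) * (sgn ψ s (y c) * sgn ψ s (y d)) ≤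
      q * ((if a = b then v a * v b else 0) * (if c = d then v c * v d else 0) +
        (if a = c then v a * v c else 0) * (if b = d then v b * v d else 0) +
        (if a = d then v a * v d else 0) * (if b = c then v b * v c else 0)) := by
    intro a b c d
    have hnn : ∀ i j, 0 ≤ if i = j then v i * v j else 0 := by
      intro i j
      split_ifs with h
      · rw [h]; exact mul_self_nonneg _
      · exact le_rfl
    have h1 := mul_nonneg (hnn a b) (hnn c d)
    have h2 := mul_nonneg (hnn a c) (hnn b d)
    have h3 := mul_nonneg (hnn a d) (hnn b c)
    by_cases h : (a = b ∧ c = d) ∨ (a = c ∧ b = d) ∨ (a = d ∧ b = c)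
    · have hs : ∑ s : F × F, sgn ψ s (y a) * sgn ψ s (y b) * (sgn ψ s (y c) * sgn ψ s (y d)) = q := by
        have : ∀ s, sgn ψ s (y a) * sgn ψ s (y b) * (sgn ψ s (y c) * sgn ψ s (y d)) = 1 := by
          intro s
          have ha := sgn_mul_self hψ' s (y a)
          have hb := sgn_mul_self hψ' s (y b)
          have hc := sgn_mul_self hψ' s (y c)
          rcases h with ⟨rfl, rfl⟩ | ⟨rfl, rfl⟩ | ⟨rfl, rfl⟩
          · rw [ha, hc, one_mul]
          · rw [mul_mul_mul_comm, ha, hb, one_mul]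
          · rw [mul_comm (sgn ψ s (y b)), mul_mul_mul_comm, ha, hb, one_mul]
        simp [this, q]
      rw [hs, mul_comm]
      refine mul_le_mul_of_nonneg_left ?_ hq
      rcases h with ⟨rfl, rfl⟩ | ⟨rfl, rfl⟩ | ⟨rfl, rfl⟩
      · rw [if_pos rfl, if_pos rfl] at h1 ⊢
        linarith
      · rw [if_pos rfl, if_pos rfl] at h2
        have : v a * v b * (v a * v b) = v a * v a * (v b * v b) := by ring
        simp only [if_true] at *
        linarith
      · rw [if_pos rfl, if_pos rfl] at h3
        have : v a * v b * (v b * v a) = v a * v a * (v b * v b) := by ring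
        simp only [if_true] at *
        linarith
    · rw [sum_sgn_four hψ, mul_zero]
      · positivity
      · simpa only [hy.eq_iff] using h
  have hexp : ∀ s : F × F, signSum ψ y v s ^ 4 = ∑ a, ∑ b, ∑ c, ∑ d, v a * v b * (v c * v d) *
      (sgn ψ s (y a) * sgn ψ s (y b) * (sgn ψ s (y c) * sgn ψ s (y d))) := by
    intro s
    have : signSum ψ y v s ^ 4 = (signSum ψ y v s * signSum ψ y v s) *
      (signSum ψ y v s * signSum ψ y v s) := by ring
    rw [this, signSum, Finset.sum_mul_sum, Finset.sum_mul]
    refine Finset.sum_congr rfl fun a _ => ?_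
    rw [Finset.sum_mul]
    refine Finset.sum_congr rfl fun b _ => ?_
    rw [Finset.mul_sum]
    refine Finset.sum_congr rfl fun c _ => ?_
    rw [Finset.mul_sum]
    exact Finset.sum_congr rfl fun d _ => by ring
  have hswap : ∑ s, signSum ψ y v s ^ 4 = ∑ a, ∑ b, ∑ c, ∑ d, v a * v b * (v c * v d) *
      ∑ s : F × F, sgn ψ s (y a) * sgn ψ s (y b) * (sgn ψ s (y c) * sgn ψ s (y d)) := by
    simp only [hexp, Finset.mul_sum]
    rw [Finset.sum_comm]
    refine Finset.sum_congr rfl fun a _ => ?_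
    rw [Finset.sum_comm]
    refine Finset.sum_congr rfl fun b _ => ?_
    rw [Finset.sum_comm]
    refine Finset.sum_congr rfl fun c _ => ?_
    rw [Finset.sum_comm]
  rw [hswap]
  calc _ ≤ ∑ a, ∑ b, ∑ c, ∑ d,
      q * ((if a = b then v a * v b else 0) * (if c = d then v c * v d else 0) +
        (if a = c then v a * v c else 0) * (if b = d then v b * v d else 0) +
        (if a = d then v a * v d else 0) * (if b = c then v b * v c else 0)) :=
        Finset.sum_le_sum fun a _ => Finset.sum_le_sum fun b _ => Finset.sum_le_sum fun c _ =>
          Finset.sum_le_sum fun d _ => hterm a b c d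
    _ = 3 * q * (∑ a, v a ^ 2) ^ 2 := by
      simp only [← Finset.mul_sum, Finset.sum_add_distrib]
      simp [← Finset.mul_sum, ← Finset.sum_mul, ← sq]
      ring

lemma sum_signSum_sq_sub_sq_le {ψ : AddChar F ℤ} (hψ : ψ.IsPrimitive) (hψ' : ∀ x, ψ x * ψ x = 1)
    (hy : Function.Injective y) (v : ι → ℤ) :
    ∑ s, (signSum ψ y v s ^ 2 - ∑ a, v a ^ 2) ^ 2 ≤
      2 * Fintype.card (F × F) * (∑ a, v a ^ 2) ^ 2 := by
  have h2 := sum_signSum_sq y hψ hψ' hy v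
  have h4 := sum_signSum_four_le y hψ hψ' hy v
  set f := ∑ a, v a ^ 2
  have : ∑ s, (signSum ψ y v s ^ 2 - f) ^ 2 =
      ∑ s, signSum ψ y v s ^ 4 - 2 * f * ∑ s, signSum ψ y v s ^ 2 +
        Fintype.card (F × F) * f ^ 2 := by
    rw [Finset.mul_sum, ← Finset.sum_sub_distrib]
    have : (Fintype.card (F × F) : ℤ) * f ^ 2 = ∑ _s : F × F, f ^ 2 := by simp
    rw [this, ← Finset.sum_add_distrib]
    exact Finset.sum_congr rfl fun s _ => by ring
  rw [this, h2]
  linarith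

end sign

/-! ### Averages and majorities -/

section tail

variable {Ω : Type} [Fintype Ω]

/-- The second moment of a sum of independent centered variables. -/
lemma card_mul_sum_sq_sum {w : ℕ} (g : Ω → ℤ) (hg : ∑ s, g s = 0) :
    (Fintype.card Ω : ℤ) * ∑ k : Fin w → Ω, (∑ j, g (k j)) ^ 2 =
      w * (Fintype.card (Fin w → Ω) * ∑ s, g s ^ 2) := by
  have hcov : ∀ i j : Fin w, (Fintype.card Ω : ℤ) * ∑ k : Fin w → Ω, g (k i) * g (k j) =
      if i = j then Fintype.card (Fin w → Ω) * ∑ s, g s ^ 2 else 0 := by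
    intro i j
    rw [← nsmul_eq_mul, ← sum_sum_update i]
    split_ifs with h
    · subst h
      simp only [Function.update_self, ← sq, Finset.sum_const, Finset.card_univ, nsmul_eq_mul]
    · refine Finset.sum_eq_zero fun k _ => ?_
      simp only [Function.update_self, Function.update_of_ne (Ne.symm h), ← Finset.sum_mul, hg,
        zero_mul]
  calc (Fintype.card Ω : ℤ) * ∑ k : Fin w → Ω, (∑ j, g (k j)) ^ 2
      = ∑ i, ∑ j, (Fintype.card Ω : ℤ) * ∑ k : Fin w → Ω, g (k i) * g (k j) := by
        simp only [sq, Finset.sum_mul_sum, ← Finset.mul_sum]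
        congr 1
        rw [Finset.sum_comm]
        refine Finset.sum_congr rfl fun i _ => ?_
        rw [Finset.sum_comm]
        simp only [Finset.mul_sum]
    _ = _ := by
        simp [hcov]

/-- If a property fails with probability at most `1 / 16`, then among `2 t` independent trials it
fails in at least half of them with probability at most `4 ^ (-t)`. -/
lemma card_majority_fails_le (t : ℕ) (P : Ω → Prop) [DecidablePred P]
    (hP : 16 * (Finset.univ.filter fun s => ¬ P s).card ≤ Fintype.card Ω) :
    4 ^ t * (Finset.univ.filter fun k : Fin (2 * t) → Ω =>
      (Finset.univ.filter fun i => P (k i)).card ≤ t).card ≤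
      Fintype.card (Fin (2 * t) → Ω) := by
  classical
  set y : Ω → ℕ := fun s => if P s then 1 else 16 with hy
  have hsum : ∑ s, y s ≤ 2 * Fintype.card Ω := by
    have : ∑ s, y s = (Finset.univ.filter P).card +
        16 * (Finset.univ.filter fun s => ¬ P s).card := by
      simp only [hy, Finset.sum_ite, Finset.sum_const, smul_eq_mul]
      ring
    have h2 : (Finset.univ.filter P).card ≤ Fintype.card Ω := Finset.card_le_univ _
    omega
  have hprod : ∀ k : Fin (2 * t) → Ω, (Finset.univ.filter fun i => P (k i)).card ≤ t →
      16 ^ t ≤ ∏ i, y (k i) := by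
    intro k hk
    have h1 : ∏ i, y (k i) = 16 ^ (Finset.univ.filter fun i => ¬ P (k i)).card := by
      simp only [hy, Finset.prod_ite, Finset.prod_const, one_pow, one_mul]
    rw [h1]
    have h2 := Finset.card_filter_add_card_filter_not (s := (Finset.univ : Finset (Fin (2 * t))))
      (fun i => P (k i))
    rw [Finset.card_univ, Fintype.card_fin] at h2
    exact Nat.pow_le_pow_right (by norm_num) (by omega)
  set B := Finset.univ.filter fun k : Fin (2 * t) → Ω =>
      (Finset.univ.filter fun i => P (k i)).card ≤ t with hB
  have hkey : 4 ^ t * (4 ^ t * B.card) ≤ 4 ^ t * Fintype.card (Fin (2 * t) → Ω) := by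
    calc 4 ^ t * (4 ^ t * B.card) = ∑ _k ∈ B, 16 ^ t := by
          rw [Finset.sum_const, smul_eq_mul, ← mul_assoc, ← mul_pow]
          ring
      _ ≤ ∑ k ∈ B, ∏ i, y (k i) :=
          Finset.sum_le_sum fun k hk => hprod k (Finset.mem_filter.1 hk).2
      _ ≤ ∑ k : Fin (2 * t) → Ω, ∏ i, y (k i) := Finset.sum_le_sum_of_subset (Finset.subset_univ _)
      _ = (∑ s, y s) ^ (2 * t) := by
          rw [Finset.sum_pow', Fintype.piFinset_univ]
      _ ≤ (2 * Fintype.card Ω) ^ (2 * t) := Nat.pow_le_pow_left hsum _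
      _ = 4 ^ t * Fintype.card (Fin (2 * t) → Ω) := by
          rw [mul_pow, pow_mul 2 2 t]
          simp
  exact Nat.le_of_mul_le_mul_left hkey (by positivity)

end tail

/-! ### The sketch for the second moment -/

section moment

variable {F : Type} [Field F] {n : ℕ}

/-- The counters of the sketch: the inner product of the frequency vector with one sign vector for
every seed, modulo `M`. -/
def momentSketch (M t w : ℕ) (ψ : AddChar F ℤ) (y : Fin n → F) (k : Fin t → Fin w → F × F)
    (x : Update n) : Fin t → Fin w → ZMod M :=
  fun i j => ((sgn ψ (k i j) (y x.1) * x.2 : ℤ) : ZMod M)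

lemma freq_append (u : List (Update n)) (x : Update n) (a : Fin n) :
    freq (u ++ [x]) a = freq u a + if x.1 = a then (x.2 : ℤ) else 0 := by
  simp [freq]

lemma signSum_freq_append (ψ : AddChar F ℤ) (y : Fin n → F) (u : List (Update n)) (x : Update n)
    (s : F × F) :
    signSum ψ y (freq (u ++ [x])) s = signSum ψ y (freq u) s + sgn ψ s (y x.1) * x.2 := by
  simp [signSum, freq_append, mul_add, Finset.sum_add_distrib]

lemma sum_map_momentSketch (M t w : ℕ) (ψ : AddChar F ℤ) (y : Fin n → F)
    (k : Fin t → Fin w → F × F) (u : List (Update n)) (i : Fin t) (j : Fin w) :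
    (u.map (momentSketch M t w ψ y k)).sum i j = (signSum ψ y (freq u) (k i j) : ZMod M) := by
  induction u using List.reverseRecOn with
  | nil => simp [signSum, freq]
  | append_singleton u x ih =>
    rw [signSum_freq_append, List.map_append, List.sum_append, Pi.add_apply, Pi.add_apply, ih]
    simp [momentSketch]

lemma abs_signSum_le {ψ : AddChar F ℤ} (hψ : ∀ x, ψ x * ψ x = 1) (y : Fin n → F)
    (u : List (Update n)) (s : F × F) : |signSum ψ y (freq u) s| ≤ u.length := by
  induction u using List.reverseRecOn with
  | nil => simp [signSum, freq]
  | append_singleton u x ih =>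
    rw [signSum_freq_append]
    have h1 : |sgn ψ s (y x.1) * x.2| = 1 := by
      rw [abs_mul, Int.isUnit_iff_abs_eq.1 x.2.isUnit, mul_one]
      exact Int.isUnit_iff_abs_eq.1 (IsUnit.of_mul_eq_one _ (hψ _))
    refine (abs_add_le _ _).trans ?_
    rw [h1]
    simp only [List.length_append, List.length_singleton]
    push_cast
    linarith

/-- The integer value of the second moment. -/
def intMoment (u : List (Update n)) : ℤ := ∑ a, freq u a ^ 2

lemma F₂_eq (u : List (Update n)) : F₂ u = (intMoment u : ℝ) := by
  simp [F₂, intMoment]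

/-- A candidate has the vote of the sketch if it is confirmed by more than half of the groups of
counters. -/
def momentVote (M m t w : ℕ) (α : ℝ) (c : Fin (2 * t) → Fin w → ZMod M) :
    Set (Fin (m ^ 2 + 1)) :=
  {z | t < Fintype.card {i // |∑ j, ((c i j).valMinAbs : ℝ) ^ 2 - w * (z : ℕ)| ≤
    α / 3 * (w * (z : ℕ))}}

/-- The candidate that equals the second moment. -/
def momentCandidate (m : ℕ) (u : List (Update n)) : Fin (m ^ 2 + 1) :=
  Fin.ofNat _ (intMoment u).toNat

variable [Fintype F] [CharP F 2]

lemma intMoment_le {ψ : AddChar F ℤ} (hψ : ψ.IsPrimitive) (hψ' : ∀ x, ψ x * ψ x = 1)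
    {y : Fin n → F} (hy : Function.Injective y) (u : List (Update n)) :
    intMoment u ≤ u.length ^ 2 := by
  have h := sum_signSum_sq y hψ hψ' hy (freq u)
  have h2 : ∑ s : F × F, signSum ψ y (freq u) s ^ 2 ≤ ∑ _s : F × F, (u.length : ℤ) ^ 2 := by
    refine Finset.sum_le_sum fun s _ => ?_
    exact sq_le_sq' (neg_le_of_abs_le (abs_signSum_le hψ' y u s))
      (le_of_abs_le (abs_signSum_le hψ' y u s))
  rw [h, Finset.sum_const, Finset.card_univ, nsmul_eq_mul] at h2
  exact le_of_mul_le_mul_left h2 (by exact_mod_cast Fintype.card_pos)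

/-- Chebyshev's inequality for the average over one group of counters. -/
lemma card_group_fails_le {ψ : AddChar F ℤ} (hψ : ψ.IsPrimitive) (hψ' : ∀ x, ψ x * ψ x = 1)
    {y : Fin n → F} (hy : Function.Injective y) {w : ℕ} {α : ℝ} (hα : 0 < α)
    (hw : 288 / α ^ 2 ≤ w) (u : List (Update n)) (P : (Fin w → F × F) → Prop) [DecidablePred P]
    (hP : ∀ k, |∑ j, (signSum ψ y (freq u) (k j) : ℝ) ^ 2 - w * intMoment u| ≤
      α / 3 * (w * intMoment u) → P k) :
    16 * (Finset.univ.filter fun k => ¬ P k).card ≤ Fintype.card (Fin w → F × F) := by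
  set f := intMoment u with hf
  set g : F × F → ℤ := fun s => signSum ψ y (freq u) s ^ 2 - f with hg
  have hg0 : ∑ s, g s = 0 := by
    simp only [hg, Finset.sum_sub_distrib, sum_signSum_sq y hψ hψ' hy]
    simp [hf, intMoment]
  have hg2 : ∑ s, g s ^ 2 ≤ 2 * Fintype.card (F × F) * f ^ 2 :=
    sum_signSum_sq_sub_sq_le y hψ hψ' hy (freq u)
  have hvar := card_mul_sum_sq_sum (w := w) g hg0
  have hcard : (0 : ℤ) < Fintype.card (F × F) := by exact_mod_cast Fintype.card_pos
  have hbound : ∑ k : Fin w → F × F, (∑ j, g (k j)) ^ 2 ≤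
      2 * w * Fintype.card (Fin w → F × F) * f ^ 2 := by
    refine le_of_mul_le_mul_left ?_ hcard
    rw [hvar]
    calc (w : ℤ) * (Fintype.card (Fin w → F × F) * ∑ s, g s ^ 2)
        ≤ w * (Fintype.card (Fin w → F × F) * (2 * Fintype.card (F × F) * f ^ 2)) := by gcongr
      _ = _ := by ring
  have hboundR : ∑ k : Fin w → F × F, (∑ j, (g (k j) : ℝ)) ^ 2 ≤
      2 * w * Fintype.card (Fin w → F × F) * (f : ℝ) ^ 2 := by exact_mod_cast hbound
  have hP' : ∀ k, ¬ P k → α / 3 * (w * f) < |∑ j, (g (k j) : ℝ)| := by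
    intro k hk
    by_contra hcon
    refine hk (hP k ?_)
    have : ∑ j, (g (k j) : ℝ) = ∑ j, (signSum ψ y (freq u) (k j) : ℝ) ^ 2 - w * f := by
      simp [hg, Finset.sum_sub_distrib]
    rw [← this]
    exact not_lt.1 hcon
  have hf0 : 0 ≤ f := Finset.sum_nonneg fun a _ => sq_nonneg _
  rcases hf0.eq_or_lt with h0 | hpos
  · have hz : ∀ k : Fin w → F × F, (∑ j, (g (k j) : ℝ)) = 0 := by
      intro k
      have h1 : ∑ k : Fin w → F × F, (∑ j, (g (k j) : ℝ)) ^ 2 ≤ 0 := by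
        refine hboundR.trans (le_of_eq ?_)
        rw [← h0]
        simp
      have h2 := Finset.single_le_sum (f := fun k : Fin w → F × F => (∑ j, (g (k j) : ℝ)) ^ 2)
        (fun _ _ => sq_nonneg _) (Finset.mem_univ k)
      exact pow_eq_zero_iff two_ne_zero |>.1 (le_antisymm (h2.trans h1) (sq_nonneg _))
    have : (Finset.univ.filter fun k => ¬ P k) = ∅ := by
      refine Finset.filter_eq_empty_iff.2 fun k _ hk => ?_
      have := hP' k hk
      rw [hz, ← h0] at this
      simp at this
    rw [this]
    simp
  · have hfR : (0 : ℝ) < f := by exact_mod_cast hpos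
    have hwα : 288 ≤ w * α ^ 2 := (div_le_iff₀ (by positivity)).1 hw
    have hwpos : (0 : ℝ) < w := lt_of_lt_of_le (by positivity) hw
    have hcheb : ((Finset.univ.filter fun k => ¬ P k).card : ℝ) * (α / 3 * (w * f)) ^ 2 ≤
        2 * w * Fintype.card (Fin w → F × F) * (f : ℝ) ^ 2 := by
      refine le_trans ?_ hboundR
      rw [← nsmul_eq_mul, ← Finset.sum_const]
      refine le_trans (Finset.sum_le_sum fun k hk => ?_)
        (Finset.sum_le_sum_of_subset_of_nonneg (Finset.subset_univ
          (Finset.univ.filter fun k => ¬ P k)) fun _ _ _ => sq_nonneg _)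
      rw [← sq_abs (∑ j, (g (k j) : ℝ))]
      exact pow_le_pow_left₀ (by positivity) (hP' k (Finset.mem_filter.1 hk).2).le 2
    have h1 : ((Finset.univ.filter fun k => ¬ P k).card : ℝ) * (w * α ^ 2) ≤
        18 * Fintype.card (Fin w → F × F) := by
      have hpos' : 0 < (w : ℝ) * f ^ 2 / 9 := by positivity
      refine le_of_mul_le_mul_left ?_ hpos'
      calc _ = ((Finset.univ.filter fun k => ¬ P k).card : ℝ) * (α / 3 * (w * f)) ^ 2 := by ring
        _ ≤ _ := hcheb
        _ = _ := by ring
    have h2 : ((Finset.univ.filter fun k => ¬ P k).card : ℝ) * 288 ≤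
        18 * Fintype.card (Fin w → F × F) :=
      le_trans (mul_le_mul_of_nonneg_left hwα (Nat.cast_nonneg _)) h1
    have h3 : 16 * ((Finset.univ.filter fun k => ¬ P k).card : ℝ) ≤
        Fintype.card (Fin w → F × F) := by linarith
    exact_mod_cast h3

lemma abs_sub_le_of_close {α w s z f : ℝ} (hα : 0 < α) (hα1 : α < 1) (hw : 0 < w) (hf : 0 ≤ f)
    (hz : |s - w * z| ≤ α / 3 * (w * z)) (hs : |s - w * f| ≤ α / 3 * (w * f)) :
    |z - f| ≤ α * f := by
  rw [abs_le] at *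
  have h1 : w * (z * (1 - α / 3)) ≤ w * (f * (1 + α / 3)) := by linarith [hz.1, hs.2]
  have h2 : w * (f * (1 - α / 3)) ≤ w * (z * (1 + α / 3)) := by linarith [hz.2, hs.1]
  have h1' := le_of_mul_le_mul_left h1 hw
  have h2' := le_of_mul_le_mul_left h2 hw
  constructor
  · by_contra hcon
    push Not at hcon
    have : z * (1 + α / 3) ≤ (f - α * f) * (1 + α / 3) :=
      mul_le_mul_of_nonneg_right (by linarith) (by linarith)
    have hlt : z * (1 + α / 3) < (f - α * f) * (1 + α / 3) :=
      mul_lt_mul_of_pos_right (by linarith) (by linarith)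
    nlinarith [mul_nonneg hf hα.le, mul_nonneg (mul_nonneg hf hα.le) hα.le]
  · by_contra hcon
    push Not at hcon
    have hlt : (f + α * f) * (1 - α / 3) < z * (1 - α / 3) :=
      mul_lt_mul_of_pos_right (by linarith) (by linarith)
    nlinarith [mul_nonneg hf hα.le, mul_nonneg (mul_nonneg hf hα.le) (sub_nonneg.2 hα1.le)]

/-- The sketch votes correctly with high probability. -/
theorem expect_not_goodSeed_le {ψ : AddChar F ℤ} (hψ : ψ.IsPrimitive)
    (hψ' : ∀ x, ψ x * ψ x = 1) {y : Fin n → F} (hy : Function.Injective y) {M m t w : ℕ} {α : ℝ}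
    (hα : 0 < α) (hα1 : α < 1) (hw : 288 / α ^ 2 ≤ w) (hM : 2 * m < M) (u : List (Update n))
    (hu : u.length ≤ m) :
    expect (PMF.uniformOfFintype (Fin (2 * t) → Fin w → F × F))
      (Set.indicator {k | ¬ GoodSeed F₂ α (votes (momentSketch M (2 * t) w ψ y)
        (momentVote M m t w α)) (fun z => ((z : ℕ) : ℝ)) (momentCandidate m) u k} 1) ≤
      (4 ^ t)⁻¹ := by
  classical
  have : NeZero M := ⟨by omega⟩
  have hwpos : (0 : ℝ) < w := lt_of_lt_of_le (by positivity) hw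
  have hf0 : 0 ≤ intMoment u := Finset.sum_nonneg fun a _ => sq_nonneg _
  have hcand : ((momentCandidate m u : ℕ) : ℝ) = intMoment u := by
    have h1 : intMoment u ≤ m ^ 2 := (intMoment_le hψ hψ' hy u).trans (by gcongr)
    have h2 : (intMoment u).toNat < m ^ 2 + 1 := by
      zify
      rw [Int.toNat_of_nonneg hf0]
      omega
    have h3 : (momentCandidate m u : ℕ) = (intMoment u).toNat := by
      simp only [momentCandidate, Fin.ofNat, Nat.mod_eq_of_lt h2]
    rw [h3]
    exact_mod_cast Int.toNat_of_nonneg hf0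
  have hcount : ∀ (k : Fin (2 * t) → Fin w → F × F) i j,
      ((u.map (momentSketch M (2 * t) w ψ y k)).sum i j).valMinAbs =
        signSum ψ y (freq u) (k i j) := by
    intro k i j
    rw [sum_map_momentSketch, ZMod.valMinAbs_spec]
    refine ⟨rfl, ?_⟩
    have h1 := abs_le.1 (abs_signSum_le hψ' y u (k i j))
    have h2 : (u.length : ℤ) ≤ m := by exact_mod_cast hu
    have h3 : 2 * (m : ℤ) < M := by exact_mod_cast hM
    constructor <;> linarith [h1.1, h1.2]
  let P : (Fin w → F × F) → Prop := fun s =>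
    |∑ j, (signSum ψ y (freq u) (s j) : ℝ) ^ 2 - w * intMoment u| ≤ α / 3 * (w * intMoment u)
  have hgroup := card_group_fails_le hψ hψ' hy hα hw u P fun k hk => hk
  have hmaj := card_majority_fails_le t P hgroup
  set B := Finset.univ.filter fun k : Fin (2 * t) → Fin w → F × F =>
      (Finset.univ.filter fun i => P (k i)).card ≤ t with hB
  have hgood : ∀ k, k ∉ B → GoodSeed F₂ α (votes (momentSketch M (2 * t) w ψ y)
        (momentVote M m t w α)) (fun z => ((z : ℕ) : ℝ)) (momentCandidate m) u k := by
    intro k hk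
    have hk' : t < (Finset.univ.filter fun i => P (k i)).card := by
      simpa [hB] using hk
    constructor
    · simp only [votes, momentVote, Set.mem_ofPred_eq, hcount, hcand]
      rwa [Fintype.card_subtype]
    · intro z hz
      simp only [votes, momentVote, Set.mem_ofPred_eq, hcount] at hz
      rw [Fintype.card_subtype] at hz
      obtain ⟨i, hi⟩ : ((Finset.univ.filter fun i => P (k i)) ∩ Finset.univ.filter fun i =>
          |∑ j, (signSum ψ y (freq u) (k i j) : ℝ) ^ 2 - w * (z : ℕ)| ≤
            α / 3 * (w * (z : ℕ))).Nonempty := by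
        by_contra hcon
        rw [Finset.not_nonempty_iff_eq_empty, ← Finset.disjoint_iff_inter_eq_empty] at hcon
        have h1 := Finset.card_union_of_disjoint hcon
        have h2 := Finset.card_le_univ ((Finset.univ.filter fun i => P (k i)) ∪
          Finset.univ.filter fun i =>
          |∑ j, (signSum ψ y (freq u) (k i j) : ℝ) ^ 2 - w * (z : ℕ)| ≤
            α / 3 * (w * (z : ℕ)))
        rw [Fintype.card_fin] at h2
        omega
      rw [Finset.mem_inter, Finset.mem_filter, Finset.mem_filter] at hi
      have hfR : (0 : ℝ) ≤ intMoment u := by exact_mod_cast hf0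
      rw [F₂_eq, abs_of_nonneg hfR]
      exact abs_sub_le_of_close hα hα1 hwpos hfR hi.2.2 hi.1.2
  rw [expect_uniform]
  calc _ ≤ (Fintype.card (Fin (2 * t) → Fin w → F × F) : ℝ≥0∞)⁻¹ * B.card := by
        gcongr
        have hsum : (B.card : ℝ≥0∞) = ∑ k, if k ∈ B then 1 else 0 := by
          rw [Finset.sum_boole, Finset.filter_univ_mem]
        rw [hsum]
        refine Finset.sum_le_sum fun k _ => ?_
        by_cases hkB : k ∈ B
        · rw [if_pos hkB]
          exact Set.indicator_le_self' (fun _ _ => zero_le) _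
        · rw [if_neg hkB, Set.indicator_of_notMem]
          exact not_not.2 (hgood k hkB)
    _ ≤ (4 ^ t)⁻¹ := by
        have h0 : (Fintype.card (Fin (2 * t) → Fin w → F × F) : ℝ≥0∞) ≠ 0 := by
          exact_mod_cast Fintype.card_ne_zero
        rw [← ENNReal.div_eq_inv_mul, ENNReal.div_le_iff h0 (ENNReal.natCast_ne_top _),
          ← ENNReal.div_eq_inv_mul, ENNReal.le_div_iff_mul_le (by simp) (by simp), mul_comm]
        exact_mod_cast hmaj

end moment

end ASA

end

noncomputable section

namespace ASA

/-! ### Degenerate parameters -/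

/-- The algorithm without memory that always responds `0`. -/
def zeroAlgorithm (X : Type) : Algorithm X 0 where
  init := PMF.pure Fin.elim0
  update s _ := PMF.pure s
  respond s := PMF.pure (s, 0)
  predicate _ _ := false
  receive s _ := PMF.pure s

lemma isRobust_zeroAlgorithm_of_one_le_left {X : Type} (g : List X → ℝ) (η m T : ℕ) {α β : ℝ}
    (hα : 1 ≤ α) (hβ : 0 ≤ β) : (zeroAlgorithm X).IsRobust g η m T α β := by
  have hacc : ∀ (adv : Adversary X) (i : ℕ), ∀ c ∈ (play η (zeroAlgorithm X) adv i).support,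
      History.Accurate g α c.2 := by
    intro adv i
    induction i with
    | zero =>
      intro c hc
      simp only [play, zeroAlgorithm, PMF.pure_bind, PMF.mem_support_pure_iff] at hc
      subst hc
      exact accurate_nil g α
    | succ i ih =>
      intro c hc
      simp only [play, playRound, zeroAlgorithm, PMF.pure_bind, PMF.mem_support_bind_iff] at hc
      obtain ⟨c', hc', move, -, hc⟩ := hc
      have h := ih c' hc'
      have hz : |(0 : ℝ) - g (c'.2.stream ++ [move.1])| ≤ α * |g (c'.2.stream ++ [move.1])| := by
        rw [zero_sub, abs_neg]
        exact le_mul_of_one_le_left (abs_nonneg _) hα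
      split_ifs at hc
      · rw [PMF.mem_support_pure_iff] at hc
        subst hc
        exact Accurate.append_some h hz
      · rw [PMF.mem_support_pure_iff] at hc
        subst hc
        exact Accurate.append_some h hz
      · rw [PMF.mem_support_pure_iff] at hc
        subst hc
        exact Accurate.append_none h _
  refine isRobust_of_expect_le hβ (fun adv => ?_) T
  rw [expect_congr (g := fun _ => 0) fun c hc =>
    Set.indicator_of_notMem (not_not.2 (hacc adv m c hc)) _, expect_const]
  exact zero_le

lemma isRobust_of_one_le {X : Type} {S : ℕ} (alg : Algorithm X S) (g : List X → ℝ) (η m T : ℕ)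
    (α : ℝ) {β : ℝ} (hβ : 1 ≤ β) : alg.IsRobust g η m T α β := by
  intro adv _
  rw [ENNReal.ofReal_of_nonpos (by linarith)]
  exact zero_le

lemma isRobust_of_isEmpty {X : Type} [IsEmpty X] {S : ℕ} (alg : Algorithm X S) (g : List X → ℝ)
    (η m T : ℕ) (α β : ℝ) : alg.IsRobust g η m T α β := by
  intro adv _
  obtain ⟨move, -⟩ := (adv []).support_nonempty
  exact isEmptyElim move.1

lemma isRobust_zero {X : Type} {S : ℕ} (alg : Algorithm X S) (g : List X → ℝ) (η T : ℕ)
    (α : ℝ) {β : ℝ} (hβ : 0 ≤ β) : alg.IsRobust g η 0 T α β := by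
  refine isRobust_of_expect_le hβ (fun adv => ?_) T
  rw [play, expect_bind, ← expect_const alg.init (ENNReal.ofReal β)]
  refine expect_mono fun s => ?_
  rw [expect_pure, Set.indicator_of_notMem (not_not.2 (accurate_nil g α))]
  exact zero_le

/-! ### Choice of the parameters -/

lemma one_add_inv_sq_pow_le {s N : ℕ} (hs : 0 < s) (hN : N ≤ s ^ 2) :
    (1 + ((s : ℝ)⁻¹) ^ 2) ^ N ≤ 4 := by
  have hsR : (0 : ℝ) < s := by exact_mod_cast hs
  calc (1 + ((s : ℝ)⁻¹) ^ 2) ^ N ≤ (1 + ((s : ℝ)⁻¹) ^ 2) ^ (s ^ 2) :=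
        pow_le_pow_right₀ (by nlinarith [sq_nonneg ((s : ℝ)⁻¹)]) hN
    _ ≤ Real.exp (((s : ℝ)⁻¹) ^ 2) ^ (s ^ 2) := by
        gcongr
        linarith [Real.add_one_le_exp (((s : ℝ)⁻¹) ^ 2)]
    _ = Real.exp 1 := by
        rw [← Real.exp_nat_mul]
        congr 1
        push_cast
        field_simp
    _ ≤ 4 := by linarith [Real.exp_one_lt_d9]

lemma two_pow_le_one_add_inv_pow {s : ℕ} (hs : 0 < s) (q : ℕ) :
    (2 : ℝ) ^ q ≤ (1 + (s : ℝ)⁻¹) ^ (q * s) := by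
  have hsR : (0 : ℝ) < s := by exact_mod_cast hs
  rw [mul_comm, pow_mul]
  refine pow_le_pow_left₀ (by norm_num) ?_ q
  have := one_add_mul_le_pow (a := (s : ℝ)⁻¹) (by linarith [inv_pos.2 hsR]) s
  rw [mul_inv_cancel₀ hsR.ne'] at this
  linarith

/-- The second moment can be estimated robustly by an algorithm whose memory is given by explicit
parameters: `l` is the length of a binary code of all parameters, and every group has `w`
counters. -/
theorem exists_isRobust_F₂ {η n m l w : ℕ} {α β : ℝ} (hη : 0 < η) (hm : 0 < m)
    (hα : 0 < α) (hα1 : α < 1) (hβ : 0 < β) (hl : 0 < l) (hn2 : n ≤ 2 ^ l) (hm2 : m ≤ 2 ^ l)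
    (hβ2 : (2 ^ l : ℝ)⁻¹ ≤ β) (hw : 288 / α ^ 2 ≤ w) (hw2 : w ≤ 2 ^ (2 * l + 9)) :
    ∃ (S : ℕ) (alg : Algorithm (Update n) S), S ≤ 10584000 * l ^ 6 * η * w ^ 2 ∧
      ∀ T, alg.IsRobust F₂ η m T α β := by
  classical
  have hwpos : 0 < w := by
    have : (0 : ℝ) < w := lt_of_lt_of_le (by positivity) hw
    exact_mod_cast this
  set F := GaloisField 2 l with hF
  let _ : Fintype F := Fintype.ofFinite F
  have hcardF : Fintype.card F = 2 ^ l := by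
    rw [← Nat.card_eq_fintype_card]
    exact GaloisField.card 2 l hl.ne'
  obtain ⟨y, hy⟩ : ∃ y : Fin n → F, Function.Injective y := by
    have : Nonempty (Fin n ↪ F) := by
      rw [Function.Embedding.nonempty_iff_card_le, hcardF, Fintype.card_fin]
      exact hn2
    obtain ⟨f⟩ := this
    exact ⟨f, f.injective⟩
  obtain ⟨ψ, hψ, hψ'⟩ := exists_signCharacter F
  set t := 35 * l with ht
  set M := 2 ^ (l + 2) with hM
  set a := 2 * l * w * (2 * t) with ha
  set b := (l + 2) * w * (2 * t) with hb
  set η' := min η m with hη'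
  set s := 6 * l * η' * b with hs
  set r := 6 * l * s with hr
  have hbpos : 0 < b := by positivity
  have hη'pos : 0 < η' := lt_min hη hm
  have hspos : 0 < s := by positivity
  have hrpos : 0 < r := by positivity
  have : NeZero M := ⟨by positivity⟩
  have hK : Fintype.card (Fin (2 * t) → Fin w → F × F) ≤ 2 ^ a := by
    simp only [Fintype.card_fun, Fintype.card_prod, Fintype.card_fin, hcardF]
    rw [← pow_add, ← pow_mul, ← pow_mul, ← two_mul, ha, mul_assoc (2 * l)]
  have hG : Fintype.card (Fin (2 * t) → Fin w → ZMod M) ≤ 2 ^ b := by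
    simp only [Fintype.card_fun, Fintype.card_fin, ZMod.card]
    rw [hM, ← pow_mul, ← pow_mul, hb, mul_assoc (l + 2)]
  have hMm : 2 * m < M := by
    have : M = 4 * 2 ^ l := by rw [hM, pow_add]; ring
    omega
  have hN : min (η * (r * b)) m ≤ s ^ 2 := by
    have h1 : s ^ 2 = η' * (r * b) := by
      rw [hr, sq]
      conv_lhs => rw [hs]
      ring
    rw [h1]
    rcases le_total η m with h | h
    · rw [hη', min_eq_left h]
      exact min_le_left _ _
    · rw [hη', min_eq_right h]
      exact (min_le_right _ _).trans (Nat.le_mul_of_pos_right m (Nat.mul_pos hrpos hbpos))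
  have hrle : m * (r * m) * 2 ^ (l + 2) ≤ 2 ^ t := by
    have hl2 : l ≤ 2 ^ l := Nat.lt_two_pow_self.le
    have hη2 : η' ≤ 2 ^ l := (min_le_right _ _).trans hm2
    have hl3 : l + 2 ≤ 3 * 2 ^ l := by omega
    calc m * (r * m) * 2 ^ (l + 2)
        = m * m * (36 * (l * l) * η' * ((l + 2) * w * (70 * l))) * 2 ^ (l + 2) := by
          rw [hr, hs, hb, ht]; ring
      _ ≤ 2 ^ l * 2 ^ l * (36 * (2 ^ l * 2 ^ l) * 2 ^ l *
            ((3 * 2 ^ l) * 2 ^ (2 * l + 9) * (70 * 2 ^ l))) * 2 ^ (l + 2) := by gcongr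
      _ = 7560 * (2 ^ (10 * l) * 2 ^ 11) := by
          simp only [pow_add, pow_mul']; ring
      _ ≤ 2 ^ 13 * (2 ^ (10 * l) * 2 ^ 11) := by gcongr; norm_num
      _ = 2 ^ (10 * l + 24) := by rw [pow_add]; ring
      _ ≤ 2 ^ t := Nat.pow_le_pow_right two_pos (by omega)
  have hfailR : (m : ℝ) * (r * (m * (2 * (2 ^ t)⁻¹)) +
      (m ^ 2 + 1) * ((1 + (s : ℝ)⁻¹) ^ r)⁻¹) ≤ β := by
    have hmR : (1 : ℝ) ≤ m := by exact_mod_cast hm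
    have hm2R : (m : ℝ) ≤ 2 ^ l := by exact_mod_cast hm2
    have h1 : (m : ℝ) * (r * (m * (2 * (2 ^ t)⁻¹))) ≤ (2 ^ l)⁻¹ / 2 := by
      have : (m : ℝ) * (r * m) * 2 ^ (l + 2) ≤ 2 ^ t := by exact_mod_cast hrle
      rw [pow_add] at this
      have ht0 : (0 : ℝ) < 2 ^ t := by positivity
      have hl0 : (0 : ℝ) < 2 ^ l := by positivity
      rw [inv_eq_one_div, inv_eq_one_div, div_div, le_div_iff₀ (by positivity)]
      calc (m : ℝ) * (r * (m * (2 * (1 / 2 ^ t)))) * (2 ^ l * 2)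
          = (m * (r * m) * (2 ^ l * 2 ^ 2)) / 2 ^ t := by field_simp
        _ ≤ 1 := (div_le_one ht0).2 this
    have h2 : (m : ℝ) * ((m ^ 2 + 1) * ((1 + (s : ℝ)⁻¹) ^ r)⁻¹) ≤ (2 ^ l)⁻¹ / 2 := by
      have hpow := two_pow_le_one_add_inv_pow hspos (6 * l)
      have hl1 : (2 : ℝ) ≤ 2 ^ l := by
        simpa using pow_le_pow_right₀ (one_le_two : (1 : ℝ) ≤ 2) hl
      calc (m : ℝ) * ((m ^ 2 + 1) * ((1 + (s : ℝ)⁻¹) ^ r)⁻¹)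
          ≤ 2 ^ l * (((2 ^ l) ^ 2 + (2 ^ l) ^ 2) * (2 ^ (6 * l))⁻¹) := by
            gcongr
            nlinarith
        _ = 2 * ((2 ^ l)⁻¹) ^ 3 := by
            rw [pow_mul']
            field_simp
            ring
        _ ≤ (2 ^ l)⁻¹ / 2 := by
            have hx : ((2 : ℝ) ^ l)⁻¹ ≤ 2⁻¹ := inv_anti₀ two_pos hl1
            have hx0 : 0 < ((2 : ℝ) ^ l)⁻¹ := by positivity
            generalize ((2 : ℝ) ^ l)⁻¹ = x at hx hx0
            have : x * x ≤ 2⁻¹ * 2⁻¹ := mul_le_mul hx hx hx0.le (by norm_num)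
            nlinarith
    rw [mul_add]
    linarith
  have hδ : ((1 + (s : NNReal)⁻¹ ^ 2 : NNReal) : ℝ≥0∞) ^ min (η * (r * b)) m * (4 ^ t)⁻¹ ≤
      ((2 * (2 ^ t)⁻¹ : NNReal) : ℝ≥0∞) ^ 2 := by
    have h4 : ((4 : ℝ≥0∞) ^ t)⁻¹ = (((4 : NNReal) ^ t)⁻¹ : NNReal) := by
      rw [ENNReal.coe_inv (by positivity), ENNReal.coe_pow]
      rfl
    rw [h4]
    norm_cast
    rw [← NNReal.coe_le_coe]
    push_cast
    have := one_add_inv_sq_pow_le hspos hN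
    calc _ ≤ 4 * ((4 : ℝ) ^ t)⁻¹ := by gcongr
      _ = _ := by
        rw [show (4 : ℝ) = 2 ^ 2 by norm_num, ← pow_mul, mul_pow, inv_pow, ← pow_mul, mul_comm 2 t]
  have hfail : m * (r * (m * ((2 * (2 ^ t)⁻¹ : NNReal) : ℝ≥0∞)) +
      Fintype.card (Fin (m ^ 2 + 1)) * (((1 + (s : NNReal)⁻¹ : NNReal) : ℝ≥0∞) ^ r)⁻¹) ≤
      ENNReal.ofReal β := by
    have hinv : (((1 + (s : NNReal)⁻¹ : NNReal) : ℝ≥0∞) ^ r)⁻¹ =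
        (((1 + (s : NNReal)⁻¹) ^ r)⁻¹ : NNReal) := by
      rw [ENNReal.coe_inv (by positivity), ENNReal.coe_pow]
    rw [hinv, Fintype.card_fin, ENNReal.ofReal]
    norm_cast
    rw [← NNReal.coe_le_coe, Real.coe_toNNReal _ hβ.le]
    push_cast
    exact hfailR
  obtain ⟨alg, halg⟩ := exists_isRobust (momentSketch M (2 * t) w ψ y) (momentVote M m t w α)
    (fun z => ((z : ℕ) : ℝ)) (momentCandidate m) hη hrpos hbpos hβ.le hK hG
    (expect_not_goodSeed_le hψ hψ' hy hα hα1 hw hMm) hδ hfail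
  refine ⟨_, alg, ?_, halg⟩
  calc 4 * r * (a + b)
      = 4 * (36 * (l * l) * η' * ((l + 2) * w * (70 * l))) *
          (2 * l * w * (70 * l) + (l + 2) * w * (70 * l)) := by
        rw [hr, hs, ha, hb, ht]; ring
    _ ≤ 4 * (36 * (l * l) * η * ((3 * l) * w * (70 * l))) *
          (2 * l * w * (70 * l) + (3 * l) * w * (70 * l)) := by
        have : l + 2 ≤ 3 * l := by omega
        have : η' ≤ η := min_le_left _ _
        gcongr
    _ = 10584000 * l ^ 6 * η * w ^ 2 := by ring

lemma exists_code_length {Y : ℝ} (hY : 3 ≤ Y) :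
    ∃ l : ℕ, 0 < l ∧ Y ≤ 2 ^ l ∧ (l : ℝ) ≤ 3 * Real.log Y := by
  have hY0 : 0 < Y := by linarith
  have hlog : 1 ≤ Real.log Y := by
    rw [Real.le_log_iff_exp_le hY0]
    linarith [Real.exp_one_lt_d9]
  refine ⟨⌈2 * Real.log Y⌉₊, Nat.ceil_pos.2 (by linarith), ?_, ?_⟩
  · rw [← Real.log_le_log_iff hY0 (by positivity), Real.log_pow]
    have h1 := Nat.le_ceil (2 * Real.log Y)
    have h2 := Real.log_two_gt_d9
    nlinarith
  · have := (Nat.ceil_lt_add_one (a := 2 * Real.log Y) (by linarith)).le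
    linarith

end ASA

end

theorem mainTheorem5 :
    ∃ (C : ℝ) (c : ℕ), 0 < C ∧
      ∀ (η n m : ℕ) (α β : ℝ), 1 ≤ η → 0 < α → 0 < β →
        ∃ (S : ℕ) (alg : ASA.Algorithm (ASA.Update n) S),
          (S : ℝ) ≤ C * ((η : ℝ) / α ^ 4) * Real.log (2 + (n : ℝ) * (m : ℝ) / (α * β)) ^ c ∧
          ∀ T : ℕ, alg.IsRobust ASA.F₂ η m T α β := by
  refine ⟨10584000 * 729 * 289 ^ 2, 6, by norm_num, ?_⟩
  intro η n m α β hη hα hβ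
  have hlog0 : 0 ≤ Real.log (2 + (n : ℝ) * (m : ℝ) / (α * β)) := by
    have : 0 ≤ (n : ℝ) * (m : ℝ) / (α * β) := by positivity
    exact Real.log_nonneg (by linarith)
  have htrivial : (∀ T : ℕ, (ASA.zeroAlgorithm (ASA.Update n)).IsRobust ASA.F₂ η m T α β) →
      ∃ (S : ℕ) (alg : ASA.Algorithm (ASA.Update n) S),
        (S : ℝ) ≤ 10584000 * 729 * 289 ^ 2 * ((η : ℝ) / α ^ 4) *
          Real.log (2 + (n : ℝ) * (m : ℝ) / (α * β)) ^ 6 ∧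
        ∀ T : ℕ, alg.IsRobust ASA.F₂ η m T α β := by
    intro h
    refine ⟨0, _, ?_, h⟩
    rw [Nat.cast_zero]
    positivity
  rcases le_or_gt 1 α with hα1 | hα1
  · exact htrivial fun T => ASA.isRobust_zeroAlgorithm_of_one_le_left _ η m T hα1 hβ.le
  rcases le_or_gt 1 β with hβ1 | hβ1
  · exact htrivial fun T => ASA.isRobust_of_one_le _ _ η m T α hβ1
  rcases Nat.eq_zero_or_pos n with rfl | hn
  · exact htrivial fun T => ASA.isRobust_of_isEmpty _ _ η m T α β
  rcases Nat.eq_zero_or_pos m with rfl | hm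
  · exact htrivial fun T => ASA.isRobust_zero _ _ η T α hβ.le
  have hnR : (1 : ℝ) ≤ n := by exact_mod_cast hn
  have hmR : (1 : ℝ) ≤ m := by exact_mod_cast hm
  have hαi : 1 ≤ α⁻¹ := (one_le_inv₀ hα).2 hα1.le
  have hβi : 1 ≤ β⁻¹ := (one_le_inv₀ hβ).2 hβ1.le
  set Y := 2 + (n : ℝ) * (m : ℝ) / (α * β) with hY
  have hYeq : Y = 2 + n * m * (α⁻¹ * β⁻¹) := by
    rw [hY, div_eq_mul_inv, mul_inv]
  have hnm : (1 : ℝ) ≤ n * m := one_le_mul_of_one_le_of_one_le hnR hmR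
  have hαβ : 1 ≤ α⁻¹ * β⁻¹ := one_le_mul_of_one_le_of_one_le hαi hβi
  have hnm_le : (n : ℝ) * m ≤ n * m * (α⁻¹ * β⁻¹) := le_mul_of_one_le_right (by positivity) hαβ
  have hαβ_le : α⁻¹ * β⁻¹ ≤ n * m * (α⁻¹ * β⁻¹) := le_mul_of_one_le_left (by positivity) hnm
  have hn_le : (n : ℝ) ≤ n * m := le_mul_of_one_le_right (by positivity) hmR
  have hm_le : (m : ℝ) ≤ n * m := le_mul_of_one_le_left (by positivity) hnR
  have hα_le : α⁻¹ ≤ α⁻¹ * β⁻¹ := le_mul_of_one_le_right (by positivity) hβi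
  have hβ_le : β⁻¹ ≤ α⁻¹ * β⁻¹ := le_mul_of_one_le_left (by positivity) hαi
  obtain ⟨l, hl, hYl, hlog⟩ := ASA.exists_code_length (Y := Y) (by linarith)
  have hα2 : 1 ≤ (α⁻¹) ^ 2 := one_le_pow₀ hαi
  have hwle : (⌈288 / α ^ 2⌉₊ : ℝ) ≤ 289 * (α⁻¹) ^ 2 := by
    have := (Nat.ceil_lt_add_one (a := 288 / α ^ 2) (by positivity)).le
    have h288 : 288 / α ^ 2 = 288 * (α⁻¹) ^ 2 := by rw [div_eq_mul_inv, inv_pow]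
    linarith
  obtain ⟨S, alg, hS, halg⟩ := ASA.exists_isRobust_F₂ (η := η) (n := n) (m := m) (l := l)
    (w := ⌈288 / α ^ 2⌉₊) hη hm hα hα1 hβ hl
    (by have : (n : ℝ) ≤ 2 ^ l := by linarith
        exact_mod_cast this)
    (by have : (m : ℝ) ≤ 2 ^ l := by linarith
        exact_mod_cast this)
    (inv_le_of_inv_le₀ hβ (by linarith)) (Nat.le_ceil _)
    (by have hα3 : α⁻¹ ≤ 2 ^ l := by linarith
        have : (⌈288 / α ^ 2⌉₊ : ℝ) ≤ 2 ^ (2 * l + 9) := by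
          refine hwle.trans ?_
          calc 289 * (α⁻¹) ^ 2 ≤ 2 ^ 9 * (2 ^ l) ^ 2 := by gcongr; norm_num
            _ = 2 ^ (2 * l + 9) := by rw [pow_add, pow_mul']; ring
        exact_mod_cast this)
  refine ⟨S, alg, ?_, halg⟩
  calc (S : ℝ) ≤ 10584000 * l ^ 6 * η * (⌈288 / α ^ 2⌉₊ : ℝ) ^ 2 := by exact_mod_cast hS
    _ ≤ 10584000 * (3 * Real.log Y) ^ 6 * η * (289 * (α⁻¹) ^ 2) ^ 2 := by gcongr
    _ = 10584000 * 729 * 289 ^ 2 * ((η : ℝ) / α ^ 4) * Real.log Y ^ 6 := by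
        rw [div_eq_mul_inv, ← inv_pow]
        ring
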